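/- Let $V$ be a finite set and let $L$ be an abstract simplicial complex with vertex set $V$ (so every $v\in V$ is a vertex of $L$; the empty simplex is counted among the simplices of $L$). Let $T_L\subseteq (S^1)^V$ be the toric complex of $L$, $$T_L=\bigcup_{\tau\in L}\{x\in (S^1)^V : x_v=1 \text{ for all } v\notin\tau\},$$ with its standard cell structure, which has one cell of dimension $|\sigma|$ for each simplex $\sigma\in L$. Let $G_L=\pi_1(T_L)$. For a commutative ring $\Bbbk$ and a $\Bbbk[G_L]$-module $A$, let $H^p(T_L,A)$ denote the (cellular) cohomology of $T_L$ with coefficients in the local system defined by $A$. For an integer $d$, call $L$ a $d$-dimensional Cohen–Macaulay complex over $\Bbbk$ if $\dim L=d$ and, for every simplex $\sigma\in L$ (including $\sigma=\emptyset$), the reduced cohomology $\widetilde H^j(\mathrm{lk}(\sigma),\Bbbk)$ vanishes for $j\ne d-|\sigma|$ and is a torsion-free $\Bbbk$-module for $j=d-|\sigma|$. **Theorem.** Let $\Bbbk$ be $\mathbb Z$ or a field, let $A=\Bbbk[G_L^{\mathrm{ab}}]$, and let $d$ be an integer. Then $L$ is a $d$-dimensional Cohen–Macaulay complex over $\Bbbk$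 if and only if $H^p(T_L,A)=0$ for all $p\neq d+1$ and $H^{d+1}(T_L,A)$ is a free $\Bbbk$-module. In particular, say that a connected CW complex $X$ with finitely many cells in each dimension is an abelian duality space of dimension $n$ if $H^p(X,\mathbb Z[\pi_1(X)^{\mathrm{ab}}])=0$ for all $p\ne n$ and $H^n(X,\mathbb Z[\pi_1(X)^{\mathrm{ab}}])$ is nonzero and torsion-free. Then $T_L$ is an abelian duality space of dimension $n$ if and only if $L$ is an $(n-1)$-dimensional Cohen–Macaulay complex over $\mathbb Z$; hence $T_L$ is an abelian duality space (of some dimension) if and only if $L$ is Cohen–Macaulay over $\mathbb Z$ (of some dimension). -/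

import Mathlib

universe u v w

noncomputable section

/-! ### Simplicial complexes: simplices, links, reduced cohomology, Cohen-Macaulayness -/

namespace PreAbstractSimplicialComplex

variable {V : Type u}

/-- The simplices of `K` in the sense of the reduced theory: the empty simplex, and the faces. -/
def simplices (K : PreAbstractSimplicialComplex V) : Set (Finset V) :=
  {σ | σ = ∅ ∨ σ ∈ K.faces}

theorem simplices_of_subset (K : PreAbstractSimplicialComplex V) {σ τ : Finset V}
    (hσ : σ ∈ K.simplices) (h : τ ⊆ σ) : τ ∈ K.simplices := by
  rcases τ.eq_empty_or_nonempty with h0 | h0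
  · exact Or.inl h0
  · rcases hσ with rfl | hσ
    · exact Or.inl (Finset.subset_empty.mp h)
    · exact Or.inr ((K.isRelLowerSet_faces hσ).2 h h0)

/-- `K` has dimension `d`: the largest simplices of `K` have exactly `d + 1` elements
(so the complex whose only simplex is `∅` has dimension `-1`). -/
def HasDim (K : PreAbstractSimplicialComplex V) (d : ℤ) : Prop :=
  (∀ σ ∈ K.simplices, (σ.card : ℤ) ≤ d + 1) ∧ ∃ σ ∈ K.simplices, (σ.card : ℤ) = d + 1

/-- The simplices of `K` with exactly `n` vertices, i.e. of dimension `n - 1`. -/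
@[ext]
structure Simplex (K : PreAbstractSimplicialComplex V) (n : ℕ) : Type u where
  /-- the set of vertices of the simplex -/
  verts : Finset V
  mem_simplices : verts ∈ K.simplices
  card_eq : verts.card = n

variable [LinearOrder V]

/-- The link of `σ`: the sets `τ` disjoint from `σ` such that `σ ∪ τ` is a simplex. -/
def link (K : PreAbstractSimplicialComplex V) (σ : Finset V) :
    PreAbstractSimplicialComplex V where
  faces := {τ | τ.Nonempty ∧ Disjoint σ τ ∧ σ ∪ τ ∈ K.simplices}
  isRelLowerSet_faces := by
    rintro τ ⟨h0, h1, h2⟩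
    refine ⟨h0, fun τ' h h' => ⟨h', h1.mono_right h, K.simplices_of_subset h2 ?_⟩⟩
    exact Finset.union_subset_union_right h

/-- The vertices of a simplex, listed in increasing order. -/
def Simplex.vertex {K : PreAbstractSimplicialComplex V} {n : ℕ} (σ : K.Simplex n) : Fin n ↪o V :=
  σ.verts.orderEmbOfFin σ.card_eq

theorem Simplex.vertex_mem {K : PreAbstractSimplicialComplex V} {n : ℕ} (σ : K.Simplex n)
    (i : Fin n) : σ.vertex i ∈ σ.verts :=
  Finset.orderEmbOfFin_mem _ _ _

theorem Simplex.exists_vertex {K : PreAbstractSimplicialComplex V} {n : ℕ} (σ : K.Simplex n)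
    {v : V} (hv : v ∈ σ.verts) : ∃ i, σ.vertex i = v := by
  have : v ∈ Set.range (σ.verts.orderEmbOfFin σ.card_eq) := by
    rwa [Finset.range_orderEmbOfFin]
  exact this

/-- The `i`-th facet of a simplex: delete its `i`-th vertex. -/
def Simplex.facet {K : PreAbstractSimplicialComplex V} {n : ℕ} (i : Fin (n + 1))
    (σ : K.Simplex (n + 1)) : K.Simplex n :=
  ⟨σ.verts.erase (σ.vertex i), K.simplices_of_subset σ.mem_simplices (Finset.erase_subset _ _), by
    rw [Finset.card_erase_of_mem (σ.vertex_mem i), σ.card_eq, Nat.add_sub_cancel]⟩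

variable (K : PreAbstractSimplicialComplex V) (k : Type w) [CommRing k]

/-- The coboundary of the augmented oriented simplicial cochain complex of `K`. A cochain on
simplices with `n` vertices has degree `n - 1`. -/
def coboundary (n : ℕ) : (K.Simplex n → k) →ₗ[k] (K.Simplex (n + 1) → k) where
  toFun f σ := ∑ i : Fin (n + 1), (-1 : k) ^ (i : ℕ) * f (σ.facet i)
  map_add' f g := by
    funext σ
    simp [mul_add, Finset.sum_add_distrib]
  map_smul' a f := by
    funext σ
    simp [Finset.mul_sum, mul_left_comm]

/-- The coboundaries among the cochains on simplices with `n` vertices. -/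
def coboundaries : (n : ℕ) → Submodule k (K.Simplex n → k)
  | 0 => ⊥
  | n + 1 => LinearMap.range (K.coboundary k n)

/-- `K.shiftedReducedCohomology k n` is the reduced simplicial cohomology of `K` over `k` in
degree `n - 1`. (There is no reduced cohomology in degrees below `-1`.) -/
abbrev shiftedReducedCohomology (n : ℕ) : Type (max u w) :=
  ↥(LinearMap.ker (K.coboundary k n)) ⧸
    (K.coboundaries k n).submoduleOf (LinearMap.ker (K.coboundary k n))

/-- `K` is a `d`-dimensional Cohen-Macaulay complex over `k`: it has dimension `d` and, for each
simplex `σ` (the empty one included), the reduced cohomology of the link of `σ` with coefficients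
in `k` vanishes in all degrees `j ≠ d - |σ|` and is torsion-free over `k` in degree
`j = d - |σ|`. Here `j = n - 1`. -/
def IsCohenMacaulay (d : ℤ) : Prop :=
  K.HasDim d ∧ ∀ σ ∈ K.simplices, ∀ n : ℕ,
    ((n : ℤ) - 1 ≠ d - σ.card → Subsingleton ((K.link σ).shiftedReducedCohomology k n)) ∧
    ((n : ℤ) - 1 = d - σ.card → Module.IsTorsionFree k ((K.link σ).shiftedReducedCohomology k n))

end PreAbstractSimplicialComplex

/-! ### Cubical cell complexes with one vertex, and their cohomology with local coefficients -/

/-- A CW structure on `X` whose only vertex is `x₀`, whose closed cells are given by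
characteristic maps on the cubes `[0,1]ⁿ`, and such that the restriction of a characteristic map
to each facet of the cube is again a characteristic map. As a set, `X` is the disjoint union of
the open cells, each in bijection with `(0,1)ⁿ`, and `X` has the weak topology. -/
structure CubicalStructure (X : Type u) [TopologicalSpace X] (x₀ : X) where
  /-- the `n`-cells -/
  Cell : ℕ → Type v
  /-- the characteristic maps -/
  char : ∀ {n : ℕ}, Cell n → C(Fin n → unitInterval, X)
  /-- the facet `xᵢ = 0` -/
  face₀ : ∀ {n : ℕ}, Fin (n + 1) → Cell (n + 1) → Cell n
  /-- the facet `xᵢ = 1` -/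
  face₁ : ∀ {n : ℕ}, Fin (n + 1) → Cell (n + 1) → Cell n
  char_face₀ : ∀ {n : ℕ} (i : Fin (n + 1)) (c : Cell (n + 1)) (x : Fin n → unitInterval),
    char (face₀ i c) x = char c (i.insertNth (α := fun _ => unitInterval) 0 x)
  char_face₁ : ∀ {n : ℕ} (i : Fin (n + 1)) (c : Cell (n + 1)) (x : Fin n → unitInterval),
    char (face₁ i c) x = char c (i.insertNth (α := fun _ => unitInterval) 1 x)
  char_corner : ∀ {n : ℕ} (c : Cell n) (x : Fin n → unitInterval), (∀ i, x i = 0 ∨ x i = 1) →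
    char c x = x₀
  existsUnique_cell : ∀ y : X, ∃! p : (Σ n : ℕ, Cell n × (Fin n → unitInterval)),
    (∀ i, 0 < p.2.2 i ∧ p.2.2 i < 1) ∧ char p.2.1 p.2.2 = y
  isClosed_of_cells : ∀ S : Set X, (∀ (n : ℕ) (c : Cell n), IsClosed (char c ⁻¹' S)) → IsClosed S

namespace CubicalStructure

variable {X : Type u} [TopologicalSpace X] {x₀ : X} (S : CubicalStructure.{u, v} X x₀)

/-- The loop at `x₀` traced by the edge of the cube from the corner `0` in direction `i`. -/
def edgePath {n : ℕ} (c : S.Cell n) (i : Fin n) : Path x₀ x₀ where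
  toFun t := S.char c (Function.update (fun _ => 0) i t)
  continuous_toFun :=
    (S.char c).continuous.comp (continuous_const.update i continuous_id)
  source' := S.char_corner c _ fun j => Or.inl (by simp [Function.update_apply])
  target' := S.char_corner c _ fun j => by
    rcases eq_or_ne j i with rfl | h
    · simp
    · simp [h]

/-- The class of `edgePath` in the fundamental group. -/
def edge {n : ℕ} (c : S.Cell n) (i : Fin n) : FundamentalGroup X x₀ :=
  FundamentalGroup.fromPath (Path.Homotopic.Quotient.mk (S.edgePath c i))

variable {k : Type w} [CommRing k] {M : Type*} [AddCommGroup M] [Module k M]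
  (ρ : Representation k (FundamentalGroup X x₀) M)

/-- The cellular (cubical) coboundary with coefficients in the local system on `X` with fibre `M`
at `x₀` and monodromy `ρ`. The value of a cochain on a cell is a vector in the fibre over the image
of the corner `0`. The `0`-corner of the facet `xᵢ = 1` is the far end of the `i`-th edge, so the
value on that facet is transported back along this edge; the facet `xᵢ = 0` has the same
`0`-corner as the cell. Equivalently, this is the complex of equivariant cochains on the cells of
the universal cover of `X`. -/
def coboundary (n : ℕ) : (S.Cell n → M) →ₗ[k] (S.Cell (n + 1) → M) where
  toFun f c := ∑ i : Fin (n + 1),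
    (-1 : k) ^ (i : ℕ) • (ρ (S.edge c i)⁻¹ (f (S.face₁ i c)) - f (S.face₀ i c))
  map_add' f g := by
    funext c
    simp only [Pi.add_apply, map_add, ← Finset.sum_add_distrib, ← smul_add]
    exact Finset.sum_congr rfl fun i _ => by rw [add_sub_add_comm]
  map_smul' a f := by
    funext c
    simp only [Pi.smul_apply, map_smul, ← smul_sub, Finset.smul_sum, RingHom.id_apply]
    exact Finset.sum_congr rfl fun i _ => smul_comm _ _ _

/-- The cellular coboundaries in degree `n`. -/
def coboundaries : (n : ℕ) → Submodule k (S.Cell n → M)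
  | 0 => ⊥
  | n + 1 => LinearMap.range (S.coboundary ρ n)

/-- The cohomology `Hⁿ(X, M)` with coefficients in the local system given by `ρ`. -/
abbrev Cohomology (n : ℕ) :=
  ↥(LinearMap.ker (S.coboundary ρ n)) ⧸
    (S.coboundaries ρ n).submoduleOf (LinearMap.ker (S.coboundary ρ n))

end CubicalStructure

/-- The group algebra `k[Gᵃᵇ]` as a representation of `G`, acting by left multiplication through
the projection `G → Gᵃᵇ`. -/
def abelianRep (k : Type w) [CommRing k] (G : Type u) [Group G] :
    Representation k G (MonoidAlgebra k (Abelianization G)) :=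
  ((Algebra.lmul k (MonoidAlgebra k (Abelianization G))).toRingHom.toMonoidHom.comp
    (MonoidAlgebra.of k (Abelianization G))).comp Abelianization.of

/-- `X`, with the given (connected) cell structure, is an abelian duality space of dimension `n`:
it has finitely many cells in each dimension, `H^p(X, ℤ[π₁(X)ᵃᵇ]) = 0` for `p ≠ n`, and
`H^n(X, ℤ[π₁(X)ᵃᵇ])` is nonzero and torsion-free. -/
def CubicalStructure.IsAbelianDualitySpace {X : Type u} [TopologicalSpace X] {x₀ : X}
    (S : CubicalStructure.{u, v} X x₀) (n : ℕ) : Prop :=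
  (∀ q, Finite (S.Cell q)) ∧
  (∀ p, p ≠ n → Subsingleton (S.Cohomology (abelianRep ℤ (FundamentalGroup X x₀)) p)) ∧
  Nontrivial (S.Cohomology (abelianRep ℤ (FundamentalGroup X x₀)) n) ∧
  Module.IsTorsionFree ℤ (S.Cohomology (abelianRep ℤ (FundamentalGroup X x₀)) n)

/-! ### Toric complexes -/

namespace AbstractSimplicialComplex

variable {V : Type u}

/-- The generalized moment-angle complex (polyhedral product) `Z_L(X, Y)`, the union over the
simplices `τ` of `L` of the sets of points `x` with `x v ∈ X` for `v ∈ τ` and `x v ∈ Y` for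
`v ∉ τ`. -/
def momentAngle (L : AbstractSimplicialComplex V) (X : Type v) (Y : Set X) : Set (V → X) :=
  ⋃ τ ∈ L.simplices, {x | ∀ v, v ∉ τ → x v ∈ Y}

/-- The toric complex `T_L = Z_L(S¹, e⁰)`, a subspace of the torus `V → S¹`. -/
abbrev Toric (L : AbstractSimplicialComplex V) : Type u :=
  ↥(L.momentAngle Circle {1})

/-- The base point of the toric complex. -/
def toricBase (L : AbstractSimplicialComplex V) : L.Toric :=
  ⟨1, Set.mem_biUnion (x := ∅) (show ∅ ∈ L.simplices from Or.inl rfl) fun _ _ => rfl⟩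

/-- The fundamental group `G_L` of the toric complex. -/
abbrev ToricGroup (L : AbstractSimplicialComplex V) : Type u :=
  FundamentalGroup L.Toric L.toricBase

variable [LinearOrder V] (L : AbstractSimplicialComplex V)

/-- The characteristic map of the cell of the toric complex given by the simplex `σ`: it sends
`x ∈ [0,1]ⁿ` to the point of the torus with coordinate `exp(2πi x_j)` at the `j`-th vertex of `σ`
and coordinate `1` at the vertices outside of `σ`. -/
def toricChar {n : ℕ} (σ : L.Simplex n) : C(Fin n → unitInterval, L.Toric) where
  toFun x := ⟨Function.extend σ.vertex
      (fun j => Circle.exp (2 * Real.pi * (x j : ℝ))) 1, by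
    refine Set.mem_biUnion (x := σ.verts) σ.mem_simplices fun v hv => ?_
    rw [Function.extend_apply']
    · rfl
    · rintro ⟨j, rfl⟩
      exact hv (σ.vertex_mem j)⟩
  continuous_toFun := by
    refine Continuous.subtype_mk (continuous_pi fun v => ?_) _
    by_cases h : ∃ j, σ.vertex j = v
    · obtain ⟨j, rfl⟩ := h
      simp only [σ.vertex.injective.extend_apply]
      fun_prop
    · simp only [Function.extend_apply' _ _ _ h]
      exact continuous_const

theorem toricChar_vertex {n : ℕ} (σ : L.Simplex n) (x : Fin n → unitInterval) (j : Fin n) :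
    (L.toricChar σ x).1 (σ.vertex j) = Circle.exp (2 * Real.pi * (x j : ℝ)) := by
  exact σ.vertex.injective.extend_apply (fun j => Circle.exp (2 * Real.pi * (x j : ℝ))) 1 j

theorem toricChar_of_notMem {n : ℕ} (σ : L.Simplex n) (x : Fin n → unitInterval) {v : V}
    (hv : v ∉ σ.verts) : (L.toricChar σ x).1 v = 1 := by
  refine Function.extend_apply' (fun j => Circle.exp (2 * Real.pi * (x j : ℝ))) (1 : V → Circle) v ?_
  rintro ⟨j, rfl⟩
  exact hv (σ.vertex_mem j)

theorem toricChar_facet {n : ℕ} (i : Fin (n + 1)) (σ : L.Simplex (n + 1)) (x : Fin n → unitInterval)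
    (ε : unitInterval) (hε : Circle.exp (2 * Real.pi * (ε : ℝ)) = 1) :
    L.toricChar (σ.facet i) x =
      L.toricChar σ (i.insertNth (α := fun _ => unitInterval) ε x) := by
  have key : ∀ j, (σ.facet i).vertex j = σ.vertex (i.succAbove j) := by
    have := Finset.orderEmbOfFin_unique (s := (σ.facet i).verts) (σ.facet i).card_eq
      (f := fun j => σ.vertex (i.succAbove j)) (fun j => by
        refine Finset.mem_erase.mpr ⟨?_, σ.vertex_mem _⟩
        exact fun h => Fin.succAbove_ne i j (σ.vertex.injective h))
      (σ.vertex.strictMono.comp (Fin.strictMono_succAbove i))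
    exact fun j => (congrFun this j).symm
  refine Subtype.ext (funext fun v => ?_)
  by_cases hv : v ∈ σ.verts
  · obtain ⟨j, rfl⟩ := σ.exists_vertex hv
    rw [toricChar_vertex]
    rcases Fin.eq_self_or_eq_succAbove i j with rfl | ⟨j, rfl⟩
    · rw [toricChar_of_notMem _ _ _ (Finset.notMem_erase _ _), Fin.insertNth_apply_same, hε]
    · rw [← key, toricChar_vertex, Fin.insertNth_apply_succAbove]
  · rw [toricChar_of_notMem _ _ _ hv, toricChar_of_notMem]
    exact fun h => hv (Finset.mem_of_mem_erase h)

theorem exp_injOn_Ico {s t : ℝ} (hs : s ∈ Set.Ico 0 1) (ht : t ∈ Set.Ico 0 1)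
    (h : Circle.exp (2 * Real.pi * s) = Circle.exp (2 * Real.pi * t)) : s = t := by
  obtain ⟨m, hm⟩ := Circle.exp_eq_exp.mp h
  have h1 : s = t + m := by
    have : (2 * Real.pi) * s = (2 * Real.pi) * (t + m) := by rw [hm]; ring
    exact mul_left_cancel₀ (by positivity) this
  have h2 : (m : ℝ) < 1 := by linarith [hs.2, ht.1]
  have h3 : (-1 : ℝ) < m := by linarith [hs.1, ht.2]
  have h4 : m < 1 := by exact_mod_cast h2
  have h5 : -1 < m := by exact_mod_cast h3
  have h6 : m = 0 := by omega
  simpa [h6] using h1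

theorem exp_ne_one {t : unitInterval} (ht : 0 < t ∧ t < 1) :
    Circle.exp (2 * Real.pi * (t : ℝ)) ≠ 1 := by
  intro h
  have h0 : (t : ℝ) = 0 := exp_injOn_Ico ⟨ht.1.le, ht.2⟩ ⟨le_rfl, one_pos⟩ (by simpa using h)
  exact ht.1.ne' (Subtype.ext h0)

theorem exists_exp_eq {z : Circle} (hz : z ≠ 1) :
    ∃ t : unitInterval, (0 < t ∧ t < 1) ∧ Circle.exp (2 * Real.pi * (t : ℝ)) = z := by
  obtain ⟨r, rfl⟩ := Circle.exp_surjective z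
  have hpi : (2 * Real.pi) ≠ 0 := by positivity
  have he : Circle.exp (2 * Real.pi * Int.fract (r / (2 * Real.pi))) = Circle.exp r := by
    refine Circle.exp_eq_exp.mpr ⟨-⌊r / (2 * Real.pi)⌋, ?_⟩
    rw [Int.fract]
    push_cast
    field_simp
    ring
  have h0 : Int.fract (r / (2 * Real.pi)) ≠ 0 := by
    intro h
    rw [h, mul_zero, Circle.exp_zero] at he
    exact hz he.symm
  have h1 := Int.fract_nonneg (r / (2 * Real.pi))
  have h2 := Int.fract_lt_one (r / (2 * Real.pi))
  refine ⟨⟨Int.fract (r / (2 * Real.pi)), h1, h2.le⟩, ⟨?_, ?_⟩, he⟩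
  · exact lt_of_le_of_ne (α := ℝ) h1 h0.symm
  · exact h2

theorem mem_verts_iff_of_interior {n : ℕ} (σ : L.Simplex n) (x : Fin n → unitInterval)
    (hx : ∀ i, 0 < x i ∧ x i < 1) (v : V) : v ∈ σ.verts ↔ (L.toricChar σ x).1 v ≠ 1 := by
  constructor
  · intro hv
    obtain ⟨j, rfl⟩ := σ.exists_vertex hv
    rw [toricChar_vertex]
    exact exp_ne_one (hx j)
  · intro h
    by_contra hv
    exact h (L.toricChar_of_notMem σ x hv)

theorem exists_cell (y : L.Toric) : ∃ (n : ℕ) (σ : L.Simplex n) (x : Fin n → unitInterval),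
    (∀ i, 0 < x i ∧ x i < 1) ∧ L.toricChar σ x = y := by
  classical
  obtain ⟨τ, hτ, hy⟩ := Set.mem_iUnion₂.mp y.2
  have hy' : ∀ v, v ∉ τ → y.1 v = 1 := hy
  let σ : L.Simplex _ :=
    ⟨τ.filter (fun v => y.1 v ≠ 1), L.simplices_of_subset hτ (Finset.filter_subset _ _), rfl⟩
  have h1 : ∀ v, v ∈ σ.verts ↔ y.1 v ≠ 1 := fun v => by
    refine (Finset.mem_filter).trans ⟨fun h => h.2, fun h => ⟨?_, h⟩⟩
    by_contra hv
    exact h (hy' v hv)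
  choose x hx hx' using fun i => exists_exp_eq ((h1 _).mp (σ.vertex_mem i))
  refine ⟨_, σ, x, hx, Subtype.ext (funext fun v => ?_)⟩
  by_cases hv : v ∈ σ.verts
  · obtain ⟨j, rfl⟩ := σ.exists_vertex hv
    rw [toricChar_vertex, hx']
  · rw [toricChar_of_notMem _ _ _ hv]
    by_contra h
    exact hv ((h1 v).mpr (Ne.symm h))

theorem cell_unique {n m : ℕ} (σ : L.Simplex n) (τ : L.Simplex m) (x : Fin n → unitInterval)
    (y : Fin m → unitInterval) (hx : ∀ i, 0 < x i ∧ x i < 1) (hy : ∀ i, 0 < y i ∧ y i < 1)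
    (h : L.toricChar σ x = L.toricChar τ y) :
    (⟨n, σ, x⟩ : Σ n : ℕ, L.Simplex n × (Fin n → unitInterval)) = ⟨m, τ, y⟩ := by
  have h1 : σ.verts = τ.verts := Finset.ext fun v => by
    rw [mem_verts_iff_of_interior L σ x hx, mem_verts_iff_of_interior L τ y hy, h]
  obtain rfl : n = m := by rw [← σ.card_eq, ← τ.card_eq, h1]
  obtain rfl : σ = τ := PreAbstractSimplicialComplex.Simplex.ext h1
  obtain rfl : x = y := funext fun j => by
    have := congrArg (fun z => z.1 (σ.vertex j)) h
    simp only [toricChar_vertex] at this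
    exact Subtype.ext
      (exp_injOn_Ico ⟨(hx j).1.le, (hx j).2⟩ ⟨(hy j).1.le, (hy j).2⟩ this)
  rfl

/-- The standard cell structure of the toric complex: the cells of dimension `n` correspond to the
simplices of `L` with `n` vertices. -/
def toricCells [Finite V] : CubicalStructure.{u, u} L.Toric L.toricBase where
  Cell n := L.Simplex n
  char σ := L.toricChar σ
  face₀ i σ := σ.facet i
  face₁ i σ := σ.facet i
  char_face₀ i σ x := L.toricChar_facet i σ x 0 (by simp)
  char_face₁ i σ x := L.toricChar_facet i σ x 1 (by simp)
  char_corner {n} σ x hx := Subtype.ext (funext fun v => by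
    change _ = (1 : Circle)
    by_cases hv : v ∈ σ.verts
    · obtain ⟨j, rfl⟩ := σ.exists_vertex hv
      rw [toricChar_vertex]
      rcases hx j with h | h <;> simp [h]
    · exact L.toricChar_of_notMem σ x hv)
  existsUnique_cell y := by
    obtain ⟨n, σ, x, hx, rfl⟩ := L.exists_cell y
    exact ⟨⟨n, σ, x⟩, ⟨hx, rfl⟩, fun p hp => L.cell_unique _ _ _ _ hp.1 hx hp.2⟩
  isClosed_of_cells S hS := by
    have h : S = ⋃ τ : Finset V, ⋃ h : τ ∈ L.simplices,
        L.toricChar ⟨τ, h, rfl⟩ '' (L.toricChar ⟨τ, h, rfl⟩ ⁻¹' S) := by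
      refine Set.Subset.antisymm (fun y hy => ?_) ?_
      · obtain ⟨n, ⟨τ, h, rfl⟩, x, -, rfl⟩ := L.exists_cell y
        exact Set.mem_iUnion₂.mpr ⟨τ, h, x, hy, rfl⟩
      · exact Set.iUnion₂_subset fun τ h => Set.image_preimage_subset _ _
    rw [h]
    exact isClosed_iUnion_of_finite fun τ => isClosed_iUnion_of_finite fun h =>
      ((hS _ _).isCompact.image (L.toricChar _).continuous).isClosed

/-- `H^p(T_L, M)`, where `M` is a representation over `k` of `G_L = π₁(T_L)`. -/
abbrev ToricCohomology [Finite V] {k : Type w} [CommRing k] {M : Type*} [AddCommGroup M]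
    [Module k M] (ρ : Representation k L.ToricGroup M) (p : ℕ) :=
  L.toricCells.Cohomology ρ p

end AbstractSimplicialComplex

end

noncomputable section

/-! ### Winding numbers of loops in the circle. -/

section Winding

/-! Let t_v be the class in G_L^ab of the loop around the v-th circle. Opposite facets of a cell of
T_L are the same cell, so the cellular cochain complex with coefficients in A = k[G_L^ab] is the
augmented simplicial one of L with A-valued cochains, twisted: deleting v from a simplex contributes
the operator x_v = t_v⁻¹ - 1. Winding numbers around the coordinate circles are dual to the t_v
(`toricWinding_toricLoop`). This independence is all that is needed, and G_L is never computed. It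
yields k-linear left inverses y_v of the x_v such that operators attached to different vertices
commute, and 1 - x_v y_v projects A onto the span of the group elements with winding number 0 at v
(`exists_isSplitFamily`).

Expanding the product over v ∈ s of x_v y_v + (1 - x_v y_v) = 1 splits the value of a cochain on s
into pieces indexed by the subsets r of s. For fixed r these pieces form, up to a shift and signs, a
direct sum of copies of the augmented cochain complex of lk(r), one for each γ in G_L^ab with
winding number 0 at every v ∈ r. Hence H^p(T_L, A) is the direct sum over such pairs (r, γ) of the
reduced cohomology of lk(r) in degree p - |r| - 1 (`nonempty_directSum_toricCohomology`).

If L is Cohen–Macaulay, vanishing is immediate, and freeness holds because a finitely generated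
torsion-free module over a PID is free. Conversely γ = 1 is allowed for every r, so the cohomology
of each link embeds in that of T_L. A maximal simplex has link {∅}, whose reduced cohomology in
degree -1 is nonzero; this forces all maximal simplices to have d + 1 vertices
(`isCohenMacaulay_of_toricCohomology`). -/

theorem zmultiplesGenerator_eq_top {G : Type*} [AddGroup G] (g : G) :
    AddSubgroup.zmultiples (⟨g, AddSubgroup.mem_zmultiples g⟩ : AddSubgroup.zmultiples g) = ⊤ := by
  rw [eq_top_iff]
  rintro ⟨x, m, rfl⟩ -
  exact ⟨m, Subtype.ext (by simp)⟩

instance infinite_zmultiples_two_pi : Infinite (AddSubgroup.zmultiples (2 * Real.pi)) := by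
  refine Infinite.of_injective
    (fun m : ℤ => (⟨m • (2 * Real.pi), m, rfl⟩ : AddSubgroup.zmultiples (2 * Real.pi))) ?_
  intro a b h
  have h' : a • (2 * Real.pi) = b • (2 * Real.pi) := congrArg Subtype.val h
  have hpi : (2 * Real.pi) ≠ 0 := by positivity
  simpa [hpi] using h'

/-- The winding number of a loop in the circle. -/
def windingNumber : FundamentalGroup Circle 1 →* Multiplicative ℤ :=
  (AddMonoidHom.toMultiplicative
    (intEquivOfZMultiplesEqTop _
      (zmultiplesGenerator_eq_top (2 * Real.pi))).symm.toAddMonoidHom).comp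
  -- Monodromy takes values in the opposite of the deck group; that group is commutative, so the
  -- opposite can be dropped.
  ((MulOpposite.opMulEquiv
      (M := Multiplicative (AddSubgroup.zmultiples (2 * Real.pi)))).symm.toMonoidHom.comp
    (Circle.isAddQuotientCoveringMap_exp.fundamentalGroupToMulOpposite
      (⟨0, by simp⟩ : Circle.exp ⁻¹' {1})))

/-- Lifts along the covering `Circle.exp` are unique, so any explicit lift starting at 0 computes
the monodromy by its endpoint. -/
theorem windingNumber_eq_of_lift (γ : Path (1 : Circle) 1) (Γ : C(unitInterval, ℝ))
    (hΓ : ∀ t, Circle.exp (Γ t) = γ t) (h0 : Γ 0 = 0) (n : ℤ) (h1 : Γ 1 = n * (2 * Real.pi)) :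
    windingNumber (FundamentalGroup.fromPath (Path.Homotopic.Quotient.mk γ)) =
      Multiplicative.ofAdd n := by
  set g : AddSubgroup.zmultiples (2 * Real.pi) := ⟨2 * Real.pi, AddSubgroup.mem_zmultiples _⟩
  have key : Circle.isAddQuotientCoveringMap_exp.fundamentalGroupToMulOpposite
      (⟨0, by simp⟩ : Circle.exp ⁻¹' {1})
      (FundamentalGroup.fromPath (Path.Homotopic.Quotient.mk γ)) =
      MulOpposite.op (Multiplicative.ofAdd (n • g)) := by
    rw [IsAddQuotientCoveringMap.fundamentalGroupToMulOpposite_apply_eq_Iff]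
    have h2 : Circle.isCoveringMap_exp.liftPath γ 0 (γ.source.trans (by simp)) = Γ :=
      ((Circle.isCoveringMap_exp.eq_liftPath_iff' _).mpr ⟨funext hΓ, h0⟩).symm
    change ((n • g : AddSubgroup.zmultiples (2 * Real.pi)) : ℝ) + 0 =
      Circle.isCoveringMap_exp.liftPath γ 0 _ 1
    rw [h2, h1]
    simp [g]
  have h3 : ∀ x, windingNumber x = Multiplicative.ofAdd
      ((intEquivOfZMultiplesEqTop _ (zmultiplesGenerator_eq_top (2 * Real.pi))).symm
        (Multiplicative.toAdd (MulOpposite.unop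
          (Circle.isAddQuotientCoveringMap_exp.fundamentalGroupToMulOpposite
            (⟨0, by simp⟩ : Circle.exp ⁻¹' {1}) x)))) := fun _ => rfl
  rw [h3, key]
  congr 1
  rw [MulOpposite.unop_op, toAdd_ofAdd, AddEquiv.symm_apply_eq]
  simp [g]

end Winding

/-! ### Loops and winding numbers in the toric complex. -/

namespace AbstractSimplicialComplex

variable {V : Type u} (L : AbstractSimplicialComplex V)

/-- A coordinate function on the toric complex. -/
def toricCoord (v : V) : C(L.Toric, Circle) where
  toFun x := x.1 v
  continuous_toFun := (continuous_apply v).comp continuous_subtype_val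

theorem toricCoord_toricBase (v : V) : L.toricCoord v L.toricBase = 1 := rfl

/-- The winding number of a loop in the toric complex around one of the circle factors. -/
def toricWinding (v : V) : Abelianization L.ToricGroup →* Multiplicative ℤ :=
  Abelianization.lift (windingNumber.comp
    (FundamentalGroup.mapOfEq (L.toricCoord v) (L.toricCoord_toricBase v)))

theorem toricWinding_of_path (v : V) (γ : Path L.toricBase L.toricBase) :
    L.toricWinding v
      (Abelianization.of (FundamentalGroup.fromPath (Path.Homotopic.Quotient.mk γ))) =
    windingNumber (FundamentalGroup.fromPath
      (Path.Homotopic.Quotient.mk ((γ.map (L.toricCoord v).continuous).cast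
        (L.toricCoord_toricBase v).symm (L.toricCoord_toricBase v).symm))) := by
  rw [toricWinding, Abelianization.lift_apply_of, MonoidHom.comp_apply,
    FundamentalGroup.mapOfEq_apply]
  rfl

variable [LinearOrder V] [Finite V]

theorem toricCells_edgePath_apply {n : ℕ} (σ : L.Simplex n) (i : Fin n) (t : unitInterval) (v : V) :
    (L.toricCells.edgePath σ i t).1 v =
      if v = σ.vertex i then Circle.exp (2 * Real.pi * (t : ℝ)) else 1 := by
  change (L.toricChar σ (Function.update (fun _ => 0) i t)).1 v = _
  by_cases hv : v ∈ σ.verts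
  · obtain ⟨j, rfl⟩ := σ.exists_vertex hv
    rw [toricChar_vertex]
    rcases eq_or_ne j i with rfl | h
    · simp
    · rw [if_neg (σ.vertex.injective.ne h)]
      simp [h]
  · rw [toricChar_of_notMem _ _ _ hv, if_neg]
    rintro rfl
    exact hv (σ.vertex_mem i)

/-- The class, in the abelianized fundamental group of the toric complex, of the circle given by
the vertex `v`. -/
def toricLoop (v : V) : Abelianization L.ToricGroup :=
  Abelianization.of (L.toricCells.edge
    (⟨{v}, Or.inr (L.singleton_mem v), Finset.card_singleton v⟩ : L.Simplex 1) 0)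

/-- The two edge paths agree as maps: along the edge only the coordinate at the i-th vertex moves.
So the monodromy along an edge of a cell depends only on the vertex that labels it. -/
theorem of_edge {n : ℕ} (σ : L.Simplex n) (i : Fin n) :
    Abelianization.of (L.toricCells.edge σ i) = L.toricLoop (σ.vertex i) := by
  rw [toricLoop]
  set τ : L.Simplex 1 :=
    ⟨{σ.vertex i}, Or.inr (L.singleton_mem _), Finset.card_singleton _⟩
  have hτ : τ.vertex 0 = σ.vertex i := Finset.mem_singleton.mp (τ.vertex_mem 0)
  have : L.toricCells.edgePath σ i = L.toricCells.edgePath τ 0 := by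
    refine Path.ext (funext fun t => ?_)
    refine Subtype.ext (funext fun v => ?_)
    rw [toricCells_edgePath_apply, toricCells_edgePath_apply, hτ]
  unfold CubicalStructure.edge
  rw [this]

/-- The v-th coordinate of the loop at u lifts to 2πs if u = v and to the constant 0 otherwise. This
duality replaces a computation of the abelianization. -/
theorem toricWinding_toricLoop (u v : V) :
    L.toricWinding v (L.toricLoop u) = if u = v then Multiplicative.ofAdd 1 else 1 := by
  unfold toricLoop CubicalStructure.edge
  rw [toricWinding_of_path]
  set τ : L.Simplex 1 := ⟨{u}, Or.inr (L.singleton_mem _), Finset.card_singleton _⟩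
  have hτ : τ.vertex 0 = u := Finset.mem_singleton.mp (τ.vertex_mem 0)
  split_ifs with h
  · subst h
    refine windingNumber_eq_of_lift _ ⟨fun t => 2 * Real.pi * (t : ℝ), by fun_prop⟩ ?_ ?_ 1 ?_
    · intro t
      refine Eq.symm ((L.toricCells_edgePath_apply τ 0 t _).trans ?_)
      rw [if_pos hτ.symm]
      rfl
    · simp
    · simp
  · refine windingNumber_eq_of_lift _ ⟨fun t => 0, by fun_prop⟩ ?_ ?_ 0 ?_
    · intro t
      refine Eq.symm ((L.toricCells_edgePath_apply τ 0 t _).trans ?_)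
      rw [if_neg (by rw [hτ]; exact Ne.symm h)]
      simp
    · simp
    · simp

end AbstractSimplicialComplex

/-! ### Commuting operators with left inverses, and the resulting idempotents. -/

section Splitting

variable {V : Type*} {E : Type*} [Ring E]

/-- The product of pairwise commuting elements over a finite set. -/
def commProd (f : V → E) (hf : ∀ v w, Commute (f v) (f w)) (s : Finset V) : E :=
  s.noncommProd f fun v _ w _ _ => hf v w

variable {f : V → E} {hf : ∀ v w, Commute (f v) (f w)}

@[simp]
theorem commProd_empty : commProd f hf ∅ = 1 := Finset.noncommProd_empty _ _

theorem commute_commProd {a : E} {s : Finset V} (h : ∀ v ∈ s, Commute a (f v)) :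
    Commute a (commProd f hf s) :=
  Finset.noncommProd_commute _ _ _ _ h

section

variable [DecidableEq V]

theorem commProd_insert {v : V} {s : Finset V} (h : v ∉ s) :
    commProd f hf (insert v s) = f v * commProd f hf s :=
  Finset.noncommProd_insert_of_notMem _ _ _ _ h

theorem commProd_insert' {v : V} {s : Finset V} (h : v ∉ s) :
    commProd f hf (insert v s) = commProd f hf s * f v :=
  Finset.noncommProd_insert_of_notMem' _ _ _ _ h

theorem mul_commProd_erase {v : V} {s : Finset V} (h : v ∈ s) :
    f v * commProd f hf (s.erase v) = commProd f hf s := by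
  rw [← commProd_insert (Finset.notMem_erase v s), Finset.insert_erase h]

theorem commProd_erase_mul {v : V} {s : Finset V} (h : v ∈ s) :
    commProd f hf (s.erase v) * f v = commProd f hf s := by
  rw [← commProd_insert' (Finset.notMem_erase v s), Finset.insert_erase h]

end

/-- A family of commuting elements `x v` with left inverses `y v` that commute with each other and
with the `x w` for `w ≠ v`. -/
structure IsSplitFamily (x y : V → E) : Prop where
  left_inv : ∀ v, y v * x v = 1
  comm_x : ∀ v w, Commute (x v) (x w)
  comm_y : ∀ v w, Commute (y v) (y w)
  comm_xy : ∀ v w, v ≠ w → Commute (x v) (y w)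

namespace IsSplitFamily

/-- The idempotent complementary to `x v * y v`. -/
def proj (x y : V → E) (v : V) : E := 1 - x v * y v

variable {x y : V → E} (h : IsSplitFamily x y)
include h

theorem proj_mul_x (v : V) : proj x y v * x v = 0 := by
  rw [proj, sub_mul, mul_assoc, h.left_inv, one_mul, mul_one, sub_self]

theorem y_mul_proj (v : V) : y v * proj x y v = 0 := by
  rw [proj, mul_sub, ← mul_assoc, h.left_inv, one_mul, mul_one, sub_self]

theorem comm_x_proj {v w : V} (hvw : v ≠ w) : Commute (x v) (proj x y w) :=
  (Commute.one_right _).sub_right ((h.comm_x v w).mul_right (h.comm_xy v w hvw))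

theorem comm_y_proj {v w : V} (hvw : v ≠ w) : Commute (y v) (proj x y w) :=
  (Commute.one_right _).sub_right ((h.comm_xy w v hvw.symm).symm.mul_right (h.comm_y v w))

theorem comm_proj (v w : V) : Commute (proj x y v) (proj x y w) := by
  rcases eq_or_ne v w with rfl | hvw
  · exact Commute.refl _
  · exact (Commute.one_left _).sub_left ((h.comm_x_proj hvw).mul_left (h.comm_y_proj hvw))

/-- The product of the `x v`. -/
def X (s : Finset V) : E := commProd x h.comm_x s

/-- The product of the `y v`. -/
def Y (s : Finset V) : E := commProd y h.comm_y s

/-- The product of the idempotents `1 - x v * y v`. -/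
def P (s : Finset V) : E := commProd (proj x y) h.comm_proj s

theorem comm_x_Y {v : V} {s : Finset V} (hv : v ∉ s) : Commute (x v) (h.Y s) :=
  commute_commProd fun w hw => h.comm_xy v w (by rintro rfl; exact hv hw)

theorem comm_y_X {v : V} {s : Finset V} (hv : v ∉ s) : Commute (y v) (h.X s) :=
  commute_commProd fun w hw => (h.comm_xy w v (by rintro rfl; exact hv hw)).symm

theorem comm_proj_Y {v : V} {s : Finset V} (hv : v ∉ s) : Commute (proj x y v) (h.Y s) :=
  commute_commProd fun w hw => (h.comm_y_proj (by rintro rfl; exact hv hw)).symm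

variable [DecidableEq V]

theorem Y_mul_X (s : Finset V) : h.Y s * h.X s = 1 := by
  induction s using Finset.induction_on with
  | empty => simp [X, Y]
  | insert v s hv ih =>
    rw [Y, X, commProd_insert' hv, commProd_insert hv, mul_assoc, ← mul_assoc (y v), h.left_inv,
      one_mul]
    exact ih

theorem Y_mul_x {v : V} {s : Finset V} (hv : v ∈ s) : h.Y s * x v = h.Y (s.erase v) := by
  rw [Y, ← commProd_erase_mul hv, mul_assoc, h.left_inv, mul_one]
  rfl

theorem P_mul_x {v : V} {s : Finset V} (hv : v ∈ s) : h.P s * x v = 0 := by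
  rw [P, ← commProd_erase_mul hv, mul_assoc, h.proj_mul_x, mul_zero]

theorem y_mul_P {v : V} {s : Finset V} (hv : v ∈ s) : y v * h.P s = 0 := by
  rw [P, ← mul_commProd_erase hv, ← mul_assoc, h.y_mul_proj, zero_mul]

/-- Since v ∉ t, `x v` moves past `Y t` and is killed by the factor `proj x y v` of `P r`. Thus the
component at r does not see the coboundary terms that delete a vertex of r. -/
theorem P_mul_Y_mul_x {v : V} {r t : Finset V} (hv : v ∈ r) (ht : Disjoint r t) :
    h.P r * h.Y t * x v = 0 := by
  rw [mul_assoc, ← (h.comm_x_Y (Finset.disjoint_left.mp ht hv)).eq, ← mul_assoc, h.P_mul_x hv,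
    zero_mul]

/-- This is the expansion of the product of `x v * y v + proj x y v = 1` over v ∈ s; r records the
vertices at which the idempotent `proj x y v` is chosen. -/
theorem sum_X_mul_P_mul_Y (s : Finset V) :
    ∑ r ∈ s.powerset, h.X (s \ r) * h.P r * h.Y (s \ r) = 1 := by
  induction s using Finset.induction_on with
  | empty => simp [X, Y, P]
  | insert v s hv ih =>
    have h1 : ∀ r ∈ s.powerset,
        h.X (insert v s \ r) * h.P r * h.Y (insert v s \ r) =
          x v * (h.X (s \ r) * h.P r * h.Y (s \ r)) * y v := fun r hr => by
      have hvr : v ∉ r := fun h' => hv (Finset.mem_powerset.mp hr h')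
      have hvs : v ∉ s \ r := fun h' => hv (Finset.mem_sdiff.mp h').1
      rw [Finset.insert_sdiff_of_notMem _ hvr, X, Y, commProd_insert hvs, commProd_insert' hvs]
      simp only [mul_assoc]
      rfl
    have h2 : ∀ r ∈ s.powerset,
        h.X (insert v s \ insert v r) * h.P (insert v r) * h.Y (insert v s \ insert v r) =
          (h.X (s \ r) * h.P r * h.Y (s \ r)) * proj x y v := fun r hr => by
      have hvr : v ∉ r := fun h' => hv (Finset.mem_powerset.mp hr h')
      have hvs : v ∉ s \ r := fun h' => hv (Finset.mem_sdiff.mp h').1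
      have h3 : insert v s \ insert v r = s \ r := by
        ext w
        simp only [Finset.mem_sdiff, Finset.mem_insert]
        grind
      rw [h3, P, commProd_insert' hvr, mul_assoc, mul_assoc, (h.comm_proj_Y hvs).eq]
      simp only [mul_assoc]
      rfl
    rw [Finset.sum_powerset_insert hv, Finset.sum_congr rfl h1, Finset.sum_congr rfl h2,
      ← Finset.sum_mul, ← Finset.sum_mul, ← Finset.mul_sum, ih, proj]
    simp

/-- Orthogonality of different components of the same simplex. If r' is a proper subset of r, a
vertex of r \ r' gives a `y v` that reaches and kills `P r`; otherwise a vertex of r' \ r gives an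
`x v` killed by `P r'`. -/
theorem P_mul_Y_mul_X_mul_P {r r' t t' : Finset V} (h0 : Disjoint r t) (h1 : Disjoint r' t')
    (h2 : r ∪ t = r' ∪ t') (hne : r' ≠ r) : h.P r' * h.Y t' * h.X t * h.P r = 0 := by
  by_cases hsub : r' ⊆ r
  · obtain ⟨v, hv, hv'⟩ := Finset.exists_of_ssubset (hsub.ssubset_of_ne hne)
    have hvt' : v ∈ t' := by
      have : v ∈ r' ∪ t' := h2 ▸ Finset.mem_union_left t hv
      exact (Finset.mem_union.mp this).resolve_left hv'
    have hvt : v ∉ t := Finset.disjoint_left.mp h0 hv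
    rw [Y, ← commProd_erase_mul hvt', mul_assoc, mul_assoc, mul_assoc, ← mul_assoc (y v),
      (h.comm_y_X hvt).eq, mul_assoc, h.y_mul_P hv, mul_zero, mul_zero, mul_zero]
  · obtain ⟨v, hv, hv'⟩ := Finset.not_subset.mp hsub
    have hvt : v ∈ t := by
      have : v ∈ r ∪ t := h2 ▸ Finset.mem_union_left t' hv
      exact (Finset.mem_union.mp this).resolve_left hv'
    rw [X, ← mul_commProd_erase hvt, ← mul_assoc, h.P_mul_Y_mul_x hv h1, zero_mul, zero_mul]

end IsSplitFamily

end Splitting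

/-! ### Splitting twisted cochains on all finite subsets. -/

section TotalComplex

variable {V : Type*} [LinearOrder V] {k : Type*} [CommRing k]

/-- The sign `(-1) ^ #{w ∈ s | w < v}`. -/
def vertexSign (k : Type*) [CommRing k] (s : Finset V) (v : V) : k :=
  (-1) ^ (s.filter (· < v)).card

theorem vertexSign_mul_self (s : Finset V) (v : V) :
    vertexSign k s v * vertexSign k s v = 1 := by
  rw [vertexSign, ← mul_pow]
  simp

theorem vertexSign_union {r t : Finset V} (h : Disjoint r t) (v : V) :
    vertexSign k (r ∪ t) v = vertexSign k r v * vertexSign k t v := by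
  rw [vertexSign, Finset.filter_union,
    Finset.card_union_of_disjoint (Finset.disjoint_filter_filter h), pow_add]
  rfl

/-- The sign of the shuffle of `r` and `t`. -/
def shuffleSign (k : Type*) [CommRing k] (r t : Finset V) : k :=
  ∏ v ∈ t, vertexSign k r v

theorem shuffleSign_mul_self (r t : Finset V) :
    shuffleSign k r t * shuffleSign k r t = 1 := by
  rw [shuffleSign, ← Finset.prod_mul_distrib]
  exact Finset.prod_eq_one fun v _ => vertexSign_mul_self r v

theorem shuffleSign_erase {r t : Finset V} {v : V} (hv : v ∈ t) :
    shuffleSign k r (t.erase v) = vertexSign k r v * shuffleSign k r t := by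
  rw [shuffleSign, shuffleSign, ← Finset.mul_prod_erase t _ hv, ← mul_assoc, vertexSign_mul_self,
    one_mul]

/-- The shuffle sign is chosen so that it converts the incidence sign of v in r ∪ t into its sign in
t. -/
theorem vertexSign_mul_shuffleSign_erase {r t : Finset V} (h : Disjoint r t) {v : V} (hv : v ∈ t) :
    vertexSign k (r ∪ t) v * shuffleSign k r (t.erase v) =
      vertexSign k t v * shuffleSign k r t := by
  rw [shuffleSign_erase hv, vertexSign_union h]
  linear_combination (vertexSign k t v * shuffleSign k r t) * vertexSign_mul_self (k := k) r v

variable {A : Type*} [AddCommGroup A] [Module k A]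

/-- The coboundary, twisted by the operators `x v`, of the cochains on all finite subsets of `V`. -/
def totalCoboundary (x : V → Module.End k A) : (Finset V → A) →ₗ[k] (Finset V → A) where
  toFun F s := ∑ v ∈ s, vertexSign k s v • x v (F (s.erase v))
  map_add' F G := by
    funext s
    simp [Finset.sum_add_distrib]
  map_smul' a F := by
    funext s
    simp [Finset.smul_sum, smul_comm _ a]

theorem totalCoboundary_apply (x : V → Module.End k A) (F : Finset V → A) (s : Finset V) :
    totalCoboundary x F s = ∑ v ∈ s, vertexSign k s v • x v (F (s.erase v)) := rfl

variable {Γ : Type*} (b : Module.Basis Γ k A) {x y : V → Module.End k A} (h : IsSplitFamily x y)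

/-- The cochain map from untwisted to twisted cochains which extends a cochain on the link of `r`
with values in the multiples of `a`. -/
def totalIncl (r : Finset V) (a : A) : (Finset V → k) →ₗ[k] (Finset V → A) where
  toFun c s := if r ⊆ s then (shuffleSign k r (s \ r) * c (s \ r)) • h.X (s \ r) a else 0
  map_add' c c' := by
    funext s
    by_cases hs : r ⊆ s <;> simp [hs, mul_add, add_smul]
  map_smul' l c := by
    funext s
    by_cases hs : r ⊆ s <;> simp [hs, mul_left_comm _ l, mul_smul]

theorem totalIncl_of_subset {r s : Finset V} (hs : r ⊆ s) (a : A) (c : Finset V → k) :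
    totalIncl h r a c s = (shuffleSign k r (s \ r) * c (s \ r)) • h.X (s \ r) a :=
  if_pos hs

theorem totalIncl_of_not_subset {r s : Finset V} (hs : ¬ r ⊆ s) (a : A) (c : Finset V → k) :
    totalIncl h r a c s = 0 :=
  if_neg hs

/-- The map from twisted to untwisted cochains which extracts the `γ`-coordinate of the component
of a cochain on the link of `r`. -/
def totalProj (r : Finset V) (γ : Γ) : (Finset V → A) →ₗ[k] (Finset V → k) where
  toFun F t :=
    if Disjoint r t then shuffleSign k r t * b.coord γ (h.P r (h.Y t (F (r ∪ t)))) else 0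
  map_add' F G := by
    funext t
    by_cases ht : Disjoint r t <;> simp [ht, mul_add]
  map_smul' l F := by
    funext t
    by_cases ht : Disjoint r t <;> simp [ht, mul_left_comm]

theorem totalProj_of_disjoint {r t : Finset V} (ht : Disjoint r t) (γ : Γ) (F : Finset V → A) :
    totalProj b h r γ F t = shuffleSign k r t * b.coord γ (h.P r (h.Y t (F (r ∪ t)))) :=
  if_pos ht

theorem totalProj_of_not_disjoint {r t : Finset V} (ht : ¬ Disjoint r t) (γ : Γ)
    (F : Finset V → A) : totalProj b h r γ F t = 0 :=
  if_neg ht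

/-- On s ⊇ r, terms deleting v ∈ r vanish because r is not contained in s \ v, and in the others `x
v` completes `X` of (s \ r) \ v to `X` of s \ r. -/
theorem totalCoboundary_totalIncl (r : Finset V) (a : A) (c : Finset V → k) :
    totalCoboundary x (totalIncl h r a c) =
      totalIncl h r a (totalCoboundary (fun _ => (1 : Module.End k k)) c) := by
  funext s
  rw [totalCoboundary_apply]
  by_cases hs : r ⊆ s
  · rw [totalIncl_of_subset h hs, totalCoboundary_apply, Finset.mul_sum, Finset.sum_smul,
      ← Finset.sum_sdiff hs]
    rw [Finset.sum_eq_zero (s := r), add_zero]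
    · refine Finset.sum_congr rfl fun v hv => ?_
      have hvr : v ∉ r := (Finset.mem_sdiff.mp hv).2
      rw [totalIncl_of_subset h (Finset.subset_erase.mpr ⟨hs, hvr⟩), Finset.erase_sdiff_comm,
        map_smul, smul_smul, ← mul_assoc]
      have h1 := vertexSign_mul_shuffleSign_erase (k := k) Finset.disjoint_sdiff hv
      rw [Finset.union_sdiff_of_subset hs] at h1
      rw [h1, ← Module.End.mul_apply, IsSplitFamily.X, mul_commProd_erase hv]
      congr 1
      simp only [Module.End.one_apply, smul_eq_mul]
      ring
    · intro v hv
      rw [totalIncl_of_not_subset, map_zero, smul_zero]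
      exact fun h' => Finset.notMem_erase v s (h' hv)
  · rw [totalIncl_of_not_subset h hs]
    refine Finset.sum_eq_zero fun v _ => ?_
    rw [totalIncl_of_not_subset, map_zero, smul_zero]
    exact fun h' => hs (h'.trans (Finset.erase_subset _ _))

/-- Terms with v ∈ r die by `P_mul_Y_mul_x`; for v ∈ t, `Y t` absorbs `x v`. Disjointness matters:
at a t meeting r in one vertex the left side need not vanish, but simplices of the link of r are
disjoint from r. -/
theorem totalCoboundary_totalProj {r t : Finset V} (ht : Disjoint r t) (γ : Γ)
    (F : Finset V → A) :
    totalCoboundary (fun _ => (1 : Module.End k k)) (totalProj b h r γ F) t =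
      totalProj b h r γ (totalCoboundary x F) t := by
  rw [totalProj_of_disjoint b h ht, totalCoboundary_apply, totalCoboundary_apply,
    Finset.sum_union ht, map_add, map_add, map_add]
  have h0 : h.P r (h.Y t (∑ v ∈ r, vertexSign k (r ∪ t) v • x v (F ((r ∪ t).erase v)))) = 0 := by
    rw [map_sum, map_sum]
    refine Finset.sum_eq_zero fun v hv => ?_
    rw [map_smul, map_smul, ← Module.End.mul_apply, ← Module.End.mul_apply,
      h.P_mul_Y_mul_x hv ht, LinearMap.zero_apply, smul_zero]
  rw [h0, map_zero, zero_add, map_sum, map_sum, map_sum, Finset.mul_sum]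
  refine Finset.sum_congr rfl fun v hv => ?_
  have hvr : v ∉ r := Finset.disjoint_right.mp ht hv
  rw [map_smul, map_smul, map_smul, ← Module.End.mul_apply (h.Y t), h.Y_mul_x hv,
    totalProj_of_disjoint b h (ht.mono_right (Finset.erase_subset _ _)),
    Finset.erase_union_distrib, Finset.erase_eq_of_notMem hvr]
  simp only [Module.End.one_apply, smul_eq_mul]
  have h2 : vertexSign k t v * shuffleSign k r (t.erase v) =
      vertexSign k (r ∪ t) v * shuffleSign k r t := by
    rw [shuffleSign_erase hv, vertexSign_union ht]
    ring
  rw [← mul_assoc, h2]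
  ring

/-- The basis `b` is adapted to the split family: the elements of `fix v` index the basis vectors
in the image of the idempotent `1 - x v * y v`, and the other coordinates vanish on this image. -/
structure IsAdapted (x y : V → Module.End k A) (fix : V → Set Γ) : Prop where
  proj_basis : ∀ v, ∀ γ ∈ fix v, IsSplitFamily.proj x y v (b γ) = b γ
  coord_proj : ∀ v, ∀ γ ∉ fix v, ∀ a, b.coord γ (IsSplitFamily.proj x y v a) = 0

variable {b} {fix : V → Set Γ} (hb : IsAdapted b x y fix)
include hb

theorem IsAdapted.P_basis {r : Finset V} {γ : Γ} (hγ : ∀ v ∈ r, γ ∈ fix v) :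
    h.P r (b γ) = b γ := by
  induction r using Finset.induction_on with
  | empty => simp [IsSplitFamily.P]
  | insert v r hv ih =>
    have h1 : h.P (insert v r) = IsSplitFamily.proj x y v * h.P r := commProd_insert hv
    rw [h1, Module.End.mul_apply, ih fun w hw => hγ w (Finset.mem_insert_of_mem hw)]
    exact hb.proj_basis v γ (hγ v (Finset.mem_insert_self v r))

theorem IsAdapted.coord_P {r : Finset V} {γ : Γ} {v : V} (hv : v ∈ r) (hγ : γ ∉ fix v) (a : A) :
    b.coord γ (h.P r a) = 0 := by
  rw [IsSplitFamily.P, ← mul_commProd_erase hv, Module.End.mul_apply]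
  exact hb.coord_proj v γ hγ _

theorem totalProj_eq_zero {r : Finset V} {γ : Γ} {v : V} (hv : v ∈ r) (hγ : γ ∉ fix v)
    (F : Finset V → A) : totalProj b h r γ F = 0 := by
  funext t
  by_cases ht : Disjoint r t
  · rw [totalProj_of_disjoint b h ht, hb.coord_P h hv hγ, mul_zero]
    rfl
  · exact totalProj_of_not_disjoint b h ht γ F

theorem totalProj_totalIncl_self {r t : Finset V} {γ : Γ} (hγ : ∀ v ∈ r, γ ∈ fix v)
    (ht : Disjoint r t) (c : Finset V → k) :
    totalProj b h r γ (totalIncl h r (b γ) c) t = c t := by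
  rw [totalProj_of_disjoint b h ht, totalIncl_of_subset h Finset.subset_union_left,
    Finset.union_sdiff_cancel_left ht, map_smul, map_smul, map_smul, ← Module.End.mul_apply (h.Y t),
    h.Y_mul_X, Module.End.one_apply, hb.P_basis h hγ, Module.Basis.coord_apply,
    Module.Basis.repr_self, Finsupp.single_eq_same, smul_eq_mul, mul_one, ← mul_assoc,
    shuffleSign_mul_self, one_mul]

theorem totalProj_totalIncl_of_ne {r r' : Finset V} {γ γ' : Γ} (hγ : ∀ v ∈ r, γ ∈ fix v)
    (hne : ¬ (r' = r ∧ γ' = γ)) (c : Finset V → k) :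
    totalProj b h r' γ' (totalIncl h r (b γ) c) = 0 := by
  funext t
  by_cases ht : Disjoint r' t
  · rw [totalProj_of_disjoint b h ht]
    by_cases hs : r ⊆ r' ∪ t
    · rw [totalIncl_of_subset h hs, map_smul, map_smul, map_smul]
      by_cases hr : r' = r
      · subst hr
        rw [Finset.union_sdiff_cancel_left ht, ← Module.End.mul_apply (h.Y t), h.Y_mul_X,
          Module.End.one_apply, hb.P_basis h hγ, Module.Basis.coord_apply,
          Module.Basis.repr_self, Finsupp.single_eq_of_ne fun h' => hne ⟨rfl, h'⟩, smul_zero,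
          mul_zero]
        rfl
      · rw [← hb.P_basis h hγ, ← Module.End.mul_apply, ← Module.End.mul_apply,
          ← Module.End.mul_apply, h.P_mul_Y_mul_X_mul_P Finset.disjoint_sdiff ht
            (Finset.union_sdiff_of_subset hs) hr, LinearMap.zero_apply, map_zero, smul_zero,
          mul_zero]
        rfl
    · rw [totalIncl_of_not_subset h hs, map_zero, map_zero, map_zero, mul_zero]
      rfl
  · exact totalProj_of_not_disjoint b h ht γ' _

-- Apply `sum_X_mul_P_mul_Y` to each value of F and expand in the basis. As V is finite, only
-- finitely many supports occur, so one finite set of basis indices serves all r and s.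
omit hb in
theorem exists_eq_sum_totalIncl_totalProj [Fintype V] (b : Module.Basis Γ k A)
    (F : Finset V → A) :
    ∃ S : Finset Γ, F = ∑ r : Finset V, ∑ γ ∈ S, totalIncl h r (b γ) (totalProj b h r γ F) := by
  classical
  refine ⟨Finset.univ.biUnion fun r => Finset.univ.biUnion fun t =>
    (b.repr (h.P r (h.Y t (F (r ∪ t))))).support, ?_⟩
  set S := Finset.univ.biUnion fun r : Finset V => Finset.univ.biUnion fun t : Finset V =>
    (b.repr (h.P r (h.Y t (F (r ∪ t))))).support with hS
  funext s
  simp only [Finset.sum_apply]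
  have h1 : ∀ r : Finset V, ∑ γ ∈ S, totalIncl h r (b γ) (totalProj b h r γ F) s =
      if r ∈ s.powerset then (h.X (s \ r) * h.P r * h.Y (s \ r)) (F s) else 0 := fun r => by
    by_cases hr : r ⊆ s
    · rw [if_pos (Finset.mem_powerset.mpr hr)]
      have h2 : (h.P r) (h.Y (s \ r) (F s)) =
          ∑ γ ∈ S, b.coord γ ((h.P r) (h.Y (s \ r) (F s))) • b γ := by
        conv_lhs => rw [← b.linearCombination_repr ((h.P r) (h.Y (s \ r) (F s)))]
        rw [Finsupp.linearCombination_apply, Finsupp.sum_of_support_subset]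
        · rfl
        · intro γ hγ
          refine Finset.mem_biUnion.mpr ⟨r, Finset.mem_univ _,
            Finset.mem_biUnion.mpr ⟨s \ r, Finset.mem_univ _, ?_⟩⟩
          rwa [Finset.union_sdiff_of_subset hr]
        · simp
      rw [Module.End.mul_apply, Module.End.mul_apply, h2, map_sum]
      refine Finset.sum_congr rfl fun γ _ => ?_
      rw [totalIncl_of_subset h hr, totalProj_of_disjoint b h Finset.disjoint_sdiff,
        Finset.union_sdiff_of_subset hr, ← mul_assoc, shuffleSign_mul_self, one_mul, map_smul]
    · rw [if_neg (by simpa using hr)]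
      exact Finset.sum_eq_zero fun γ _ => totalIncl_of_not_subset h hr _ _
  simp_rw [h1]
  rw [Finset.sum_ite_mem, Finset.univ_inter, ← LinearMap.sum_apply, h.sum_X_mul_P_mul_Y,
    Module.End.one_apply]

end TotalComplex

/-! ### Restriction from all finite subsets to the simplices of a complex. -/

section Simplicial

namespace PreAbstractSimplicialComplex

variable {V : Type u} {k : Type w} [CommRing k] {A : Type*} [AddCommGroup A] [Module k A]
  (K : PreAbstractSimplicialComplex V)

/-- Restriction of a cochain on all finite sets to the simplices with `n` vertices. -/
def restrict (k : Type w) [CommRing k] (A : Type*) [AddCommGroup A] [Module k A] (n : ℕ) :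
    (Finset V → A) →ₗ[k] (K.Simplex n → A) :=
  LinearMap.funLeft k A Simplex.verts

@[simp]
theorem restrict_apply (n : ℕ) (F : Finset V → A) (σ : K.Simplex n) :
    K.restrict k A n F σ = F σ.verts := rfl

theorem restrict_eq_iff {n : ℕ} {F G : Finset V → A} :
    K.restrict k A n F = K.restrict k A n G ↔
      ∀ s ∈ K.simplices, s.card = n → F s = G s :=
  ⟨fun h s hs hn => congrFun h ⟨s, hs, hn⟩,
    fun h => funext fun σ => h _ σ.mem_simplices σ.card_eq⟩

open Classical in
/-- Extension by zero of a cochain on the simplices with `n` vertices to all finite sets. -/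
def extend (k : Type w) [CommRing k] (A : Type*) [AddCommGroup A] [Module k A] (n : ℕ) :
    (K.Simplex n → A) →ₗ[k] (Finset V → A) where
  toFun f s := if h : s ∈ K.simplices ∧ s.card = n then f ⟨s, h.1, h.2⟩ else 0
  map_add' f g := by
    funext s
    by_cases h : s ∈ K.simplices ∧ s.card = n <;> simp [h]
  map_smul' a f := by
    funext s
    by_cases h : s ∈ K.simplices ∧ s.card = n <;> simp [h]

@[simp]
theorem restrict_extend (n : ℕ) (f : K.Simplex n → A) :
    K.restrict k A n (K.extend k A n f) = f :=
  funext fun σ => dif_pos ⟨σ.mem_simplices, σ.card_eq⟩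

variable [LinearOrder V]

variable {K} in
theorem Simplex.image_vertex {n : ℕ} (σ : K.Simplex n) :
    Finset.univ.map σ.vertex.toEmbedding = σ.verts := by
  rw [Simplex.vertex]
  exact Finset.map_orderEmbOfFin_univ _ _

variable {K} in
theorem Simplex.vertexSign_vertex {n : ℕ} (σ : K.Simplex n) (i : Fin n) :
    vertexSign k σ.verts (σ.vertex i) = (-1) ^ (i : ℕ) := by
  rw [vertexSign, ← σ.image_vertex, Finset.filter_map, Finset.card_map]
  congr 1
  have : (Finset.univ.filter ((· < σ.vertex i) ∘ σ.vertex.toEmbedding)) = Finset.Iio i := by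
    ext j
    simp
  rw [this, Fin.card_Iio]

-- The i-th vertex has exactly i vertices of σ below it, so the unordered signed sum matches the sum
-- over ordered facets.
variable {K} in
theorem totalCoboundary_verts {n : ℕ} (x : V → Module.End k A) (F : Finset V → A)
    (σ : K.Simplex (n + 1)) :
    totalCoboundary x F σ.verts =
      ∑ i : Fin (n + 1), (-1 : k) ^ (i : ℕ) • x (σ.vertex i) (F (σ.facet i).verts) := by
  rw [totalCoboundary_apply]
  conv_lhs => rw [← σ.image_vertex]
  rw [Finset.sum_map]
  refine Finset.sum_congr rfl fun i _ => ?_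
  rw [σ.image_vertex]
  change vertexSign k σ.verts (σ.vertex i) • _ = _
  rw [σ.vertexSign_vertex]
  rfl

theorem restrict_zero_totalCoboundary (x : V → Module.End k A) (F : Finset V → A) :
    K.restrict k A 0 (totalCoboundary x F) = 0 := by
  funext σ
  rw [restrict_apply, Finset.card_eq_zero.mp σ.card_eq, totalCoboundary_apply, Finset.sum_empty]
  rfl

theorem coboundary_restrict (n : ℕ) (F : Finset V → k) :
    K.coboundary k n (K.restrict k k n F) =
      K.restrict k k (n + 1) (totalCoboundary (fun _ => (1 : Module.End k k)) F) := by
  funext σ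
  rw [restrict_apply, totalCoboundary_verts]
  rfl

/-- This form is uniform in n: for n = 0 the total coboundary restricts to zero. -/
theorem mem_coboundaries_iff {n : ℕ} {f : K.Simplex n → k} :
    f ∈ K.coboundaries k n ↔
      ∃ F, K.restrict k k n (totalCoboundary (fun _ => (1 : Module.End k k)) F) = f := by
  cases n with
  | zero =>
    simp only [restrict_zero_totalCoboundary, exists_const]
    exact (Submodule.mem_bot k).trans eq_comm
  | succ n =>
    refine ⟨fun ⟨g, hg⟩ => ⟨K.extend k k n g, ?_⟩, fun ⟨F, hF⟩ => ⟨K.restrict k k n F, ?_⟩⟩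
    · rw [← coboundary_restrict, restrict_extend, hg]
    · rw [coboundary_restrict, hF]

theorem mem_simplices_link {s t : Finset V} (hs : s ∈ K.simplices) :
    t ∈ (K.link s).simplices ↔ Disjoint s t ∧ s ∪ t ∈ K.simplices := by
  rcases t.eq_empty_or_nonempty with rfl | ht
  · simpa [simplices] using hs
  · simp only [simplices, Set.mem_ofPred_eq, ht.ne_empty, false_or]
    exact ⟨fun h => h.2, fun h => ⟨ht, h⟩⟩

variable {x y : V → Module.End k A} (h : IsSplitFamily x y)

/-- The value at s uses c only at s \ r, which is a simplex of the link of r when s is a simplex.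
Hence the maps between total cochains descend to the complexes themselves. -/
theorem restrict_totalIncl_congr {r : Finset V} (hr : r ∈ K.simplices) (a : A) {m p : ℕ}
    (hm : r.card + m = p) {c c' : Finset V → k}
    (hc : (K.link r).restrict k k m c = (K.link r).restrict k k m c') :
    K.restrict k A p (totalIncl h r a c) = K.restrict k A p (totalIncl h r a c') := by
  rw [restrict_eq_iff] at hc ⊢
  intro s hs hp
  by_cases hrs : r ⊆ s
  · rw [totalIncl_of_subset h hrs, totalIncl_of_subset h hrs, hc]
    · rw [mem_simplices_link _ hr, Finset.union_sdiff_of_subset hrs]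
      exact ⟨Finset.disjoint_sdiff, hs⟩
    · rw [Finset.card_sdiff_of_subset hrs]
      omega
  · rw [totalIncl_of_not_subset h hrs, totalIncl_of_not_subset h hrs]

theorem restrict_totalIncl_eq_zero {r : Finset V} (a : A) {p : ℕ}
    (hr : ¬ (r ∈ K.simplices ∧ r.card ≤ p)) (c : Finset V → k) :
    K.restrict k A p (totalIncl h r a c) = 0 := by
  rw [← map_zero (K.restrict k A p), restrict_eq_iff]
  intro s hs hp
  refine totalIncl_of_not_subset h (fun hrs => hr ⟨K.simplices_of_subset hs hrs, ?_⟩) a c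
  exact hp ▸ Finset.card_le_card hrs

variable {Γ : Type*} (b : Module.Basis Γ k A)

theorem restrict_totalProj_congr {r : Finset V} (hr : r ∈ K.simplices) (γ : Γ) {m p : ℕ}
    (hm : r.card + m = p) {F G : Finset V → A}
    (hF : K.restrict k A p F = K.restrict k A p G) :
    (K.link r).restrict k k m (totalProj b h r γ F) =
      (K.link r).restrict k k m (totalProj b h r γ G) := by
  rw [restrict_eq_iff] at hF ⊢
  intro t ht htm
  rw [mem_simplices_link _ hr] at ht
  rw [totalProj_of_disjoint b h ht.1, totalProj_of_disjoint b h ht.1, hF _ ht.2]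
  rw [Finset.card_union_of_disjoint ht.1, htm, hm]

theorem restrict_totalCoboundary_totalProj {r : Finset V} (hr : r ∈ K.simplices) (γ : Γ) (m : ℕ)
    (F : Finset V → A) :
    (K.link r).restrict k k m
        (totalCoboundary (fun _ => (1 : Module.End k k)) (totalProj b h r γ F)) =
      (K.link r).restrict k k m (totalProj b h r γ (totalCoboundary x F)) := by
  rw [restrict_eq_iff]
  intro t ht _
  exact totalCoboundary_totalProj b h ((mem_simplices_link _ hr).mp ht).1 γ F

end PreAbstractSimplicialComplex

end Simplicial

/-! ### Direct sum decompositions of subquotients. -/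

section Subquotient

variable {k : Type*} [CommRing k] {C : Type*} [AddCommGroup C] [Module k C] {C' : Type*}
  [AddCommGroup C'] [Module k C']

/-- The map of subquotients induced by a linear map. -/
def subquotientMap {Z B : Submodule k C} {Z' B' : Submodule k C'} (φ : C →ₗ[k] C')
    (hZ : ∀ c ∈ Z, φ c ∈ Z') (hB : ∀ c ∈ B, φ c ∈ B') :
    (Z ⧸ B.submoduleOf Z) →ₗ[k] (Z' ⧸ B'.submoduleOf Z') :=
  Submodule.mapQ _ _ (φ.restrict hZ) fun c hc => hB c hc

/-- A decomposition of a subquotient as a direct sum of subquotients. -/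
theorem nonempty_subquotient_linearEquiv_directSum {ι : Type*} {D : ι → Type*}
    [∀ i, AddCommGroup (D i)] [∀ i, Module k (D i)] {Z B : Submodule k C}
    {Z' B' : ∀ i, Submodule k (D i)} (j : ∀ i, D i →ₗ[k] C) (r : ∀ i, C →ₗ[k] D i)
    (hjZ : ∀ i, ∀ c ∈ Z' i, j i c ∈ Z) (hjB : ∀ i, ∀ c ∈ B' i, j i c ∈ B)
    (hrZ : ∀ i, ∀ c ∈ Z, r i c ∈ Z' i) (hrB : ∀ i, ∀ c ∈ B, r i c ∈ B' i)
    (hself : ∀ i c, r i (j i c) = c) (hne : ∀ i i', i' ≠ i → ∀ c, r i' (j i c) = 0)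
    (hspan : ∀ c, c ∈ Submodule.span k (Set.range fun i => j i (r i c))) :
    Nonempty ((DirectSum ι fun i => (Z' i) ⧸ (B' i).submoduleOf (Z' i)) ≃ₗ[k]
      (Z ⧸ B.submoduleOf Z)) := by
  classical
  let J := fun i => subquotientMap (j i) (hjZ i) (hjB i)
  let R := fun i => subquotientMap (r i) (hrZ i) (hrB i)
  let T := DirectSum.toModule k ι (Z ⧸ B.submoduleOf Z) J
  -- The retractions recover all components, which gives injectivity of `T`.
  have hRT : ∀ i, (R i).comp T = DirectSum.component k ι _ i := fun i => by
    refine DirectSum.linearMap_ext k fun i' => LinearMap.ext fun c => ?_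
    obtain ⟨c, rfl⟩ := Submodule.Quotient.mk_surjective _ c
    rw [LinearMap.comp_apply, LinearMap.comp_apply, LinearMap.comp_apply, DirectSum.toModule_lof]
    change Submodule.Quotient.mk (⟨r i (j i' c), hrZ i _ (hjZ i' _ c.2)⟩ : Z' i) = _
    rcases eq_or_ne i i' with rfl | hi
    · rw [DirectSum.component.lof_self]
      congr 1
      exact Subtype.ext (hself i c)
    · rw [DirectSum.component.of, dif_neg hi.symm, Submodule.Quotient.mk_eq_zero]
      change r i (j i' c) ∈ B' i
      rw [hne i' i hi]
      exact zero_mem _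
  refine ⟨LinearEquiv.ofBijective T ⟨?_, ?_⟩⟩
  · intro c c' hc
    refine DirectSum.ext_component k fun i => ?_
    rw [← hRT, LinearMap.comp_apply, hc, LinearMap.comp_apply]
  · intro q
    obtain ⟨c, rfl⟩ := Submodule.Quotient.mk_surjective _ q
    -- The elements of `Z` whose class lies in the range of `T`; by `hspan` it suffices that `N`
    -- contains each component of `c`.
    let N : Submodule k C :=
      ((LinearMap.range T).comap (Submodule.mkQ (B.submoduleOf Z))).map Z.subtype
    have hN : ∀ i, j i (r i c) ∈ N := fun i =>
      ⟨⟨_, hjZ i _ (hrZ i _ c.2)⟩,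
        ⟨DirectSum.lof k ι _ i (Submodule.Quotient.mk ⟨_, hrZ i _ c.2⟩), by
          rw [DirectSum.toModule_lof]
          rfl⟩, rfl⟩
    obtain ⟨c', hc', hcc'⟩ : (c : C) ∈ N :=
      Submodule.span_le.mpr (Set.range_subset_iff.mpr hN) (hspan c)
    rw [← Subtype.ext hcc']
    exact hc'

end Subquotient

/-! ### Dividing by t⁻¹ - 1 in a group ring. -/

section GroupRing

/-- Applied to the powers of an element u, this gives the geometric sum (u ^ m - 1) / (u - 1) for
all integers m, without division. -/
theorem exists_int_antidifference {M : Type*} [AddCommGroup M] (f : ℤ → M) :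
    ∃ G : ℤ → M, G 0 = 0 ∧ ∀ m, G (m + 1) = G m + f m := by
  refine ⟨fun m => (∑ i ∈ Finset.range m.toNat, f i) -
    ∑ i ∈ Finset.range (-m).toNat, f (-(i + 1)), by simp, fun m => ?_⟩
  obtain ⟨n, rfl | rfl⟩ := m.eq_nat_or_neg
  · have h1 : ((n : ℤ) + 1).toNat = n + 1 := by omega
    have h2 : (-((n : ℤ) + 1)).toNat = 0 := by omega
    have h3 : (-(n : ℤ)).toNat = 0 := by omega
    simp only [h1, h2, h3, Int.toNat_natCast, Finset.sum_range_succ, Finset.range_zero,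
      Finset.sum_empty, sub_zero]
  · cases n with
    | zero => simp
    | succ n =>
      have h1 : (-((n + 1 : ℕ) : ℤ) + 1).toNat = 0 := by omega
      have h2 : (-(-((n + 1 : ℕ) : ℤ) + 1)).toNat = n := by omega
      have h3 : (-((n + 1 : ℕ) : ℤ)).toNat = 0 := by omega
      have h4 : (-(-((n + 1 : ℕ) : ℤ))).toNat = n + 1 := by omega
      simp only [h1, h2, h3, h4, Finset.sum_range_succ, Finset.range_zero, Finset.sum_empty]
      push_cast
      abel

variable {V : Type*} [DecidableEq V] {Γ : Type*} [CommGroup Γ] (k : Type*) [CommRing k]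

open MonoidAlgebra in
/-- The operators `t v⁻¹ - 1` on a group ring, where the `t v` are independent elements of the group
in the sense that there is a dual family of homomorphisms to `ℤ`, form a split family, to which the
basis of the group elements is adapted. -/
theorem exists_isSplitFamily (t : V → Γ) (ω : V → Γ →* Multiplicative ℤ)
    (hω : ∀ u v, ω v (t u) = if u = v then Multiplicative.ofAdd 1 else 1)
    (b : Module.Basis Γ k (MonoidAlgebra k Γ)) (hb : ∀ γ, b γ = of k Γ γ)
    (x : V → Module.End k (MonoidAlgebra k Γ))
    (hx : ∀ v a, x v a = of k Γ (t v)⁻¹ * a - a) :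
    ∃ y : V → Module.End k (MonoidAlgebra k Γ), IsSplitFamily x y ∧
      IsAdapted b x y (fun v => {γ | ω v γ = 1}) := by
  choose G hG0 hG using fun v : V =>
    exists_int_antidifference fun m : ℤ => of k Γ ((t v)⁻¹ ^ m)
  let n : V → Γ → ℤ := fun v γ => Multiplicative.toAdd (ω v γ)
  -- The translate of γ by a power of `t v` that has winding number 0 at v.
  let p : V → Γ → Γ := fun v γ => γ * (t v) ^ (-n v γ)
  -- With u = (t v)⁻¹ and m = -n v γ one has γ = u ^ m * p v γ. Thus `y v` sends γ to the quotient
  -- of γ - p v γ by u - 1, and p v γ is the remainder.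
  let y : V → Module.End k (MonoidAlgebra k Γ) := fun v =>
    b.constr k fun γ => G v (-n v γ) * of k Γ (p v γ)
  have hn : ∀ v γ γ', n v (γ * γ') = n v γ + n v γ' := fun v γ γ' => by simp [n]
  have hninv : ∀ v γ, n v γ⁻¹ = - n v γ := fun v γ => by simp [n]
  have hnpow : ∀ v γ (m : ℤ), n v (γ ^ m) = m * n v γ := fun v γ m => by simp [n]
  have hnt : ∀ u v, n v (t u) = if u = v then 1 else 0 := fun u v => by
    simp only [n, hω]
    split_ifs <;> rfl
  have hy : ∀ v γ, y v (of k Γ γ) = G v (-n v γ) * of k Γ (p v γ) := fun v γ => by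
    rw [← hb, Module.Basis.constr_basis]
  -- Telescoping of the geometric sum, by induction upwards and downwards from 0.
  have hGmul : ∀ v m, of k Γ (t v)⁻¹ * G v m - G v m = of k Γ ((t v)⁻¹ ^ m) - 1 := fun v m => by
    have hstep : ∀ m : ℤ, of k Γ (t v)⁻¹ * of k Γ ((t v)⁻¹ ^ m) = of k Γ ((t v)⁻¹ ^ (m + 1)) :=
      fun m => by rw [← map_mul, zpow_add_one, mul_comm]
    induction m using Int.induction_on with
    | zero => rw [hG0, mul_zero, sub_zero, zpow_zero, map_one, sub_self]
    | succ m ih =>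
      rw [hG, mul_add, hstep]
      linear_combination ih
    | pred m ih =>
      have h1 := hG v (-(m : ℤ) - 1)
      have h2 := hstep (-(m : ℤ) - 1)
      rw [sub_add_cancel] at h1 h2
      rw [h1, mul_add, h2] at ih
      linear_combination ih
  have hxof : ∀ v γ, x v (of k Γ γ) = of k Γ ((t v)⁻¹ * γ) - of k Γ γ := fun v γ => by
    rw [hx, map_mul]
  have hproj : ∀ v γ, IsSplitFamily.proj x y v (of k Γ γ) = of k Γ (p v γ) := fun v γ => by
    have h1 : (t v)⁻¹ ^ (-n v γ) * p v γ = γ := by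
      simp only [p, inv_zpow']
      rw [neg_neg, mul_comm, mul_assoc, ← zpow_add]
      simp
    rw [IsSplitFamily.proj, LinearMap.sub_apply, Module.End.one_apply, Module.End.mul_apply, hy,
      hx, ← mul_assoc, ← sub_mul, hGmul, sub_mul, ← map_mul, h1, one_mul, sub_sub_cancel]
  -- multiplication by a group element on which `ω v` vanishes commutes with `y v`
  have hymul : ∀ v γ, n v γ = 0 → ∀ a, y v (of k Γ γ * a) = of k Γ γ * y v a := fun v γ hγ => by
    suffices h : (y v) ∘ₗ LinearMap.mulLeft k (of k Γ γ) = LinearMap.mulLeft k (of k Γ γ) ∘ₗ y v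
      from fun a => LinearMap.congr_fun h a
    refine b.ext fun γ' => ?_
    rw [hb, LinearMap.comp_apply, LinearMap.comp_apply, LinearMap.mulLeft_apply,
      LinearMap.mulLeft_apply, ← map_mul, hy, hy, hn, hγ, zero_add, mul_left_comm, ← map_mul]
    congr 2
    simp only [p, hn, hγ, zero_add, mul_assoc]
  -- `G w m` is a signed sum of powers of `t w`, all of winding number 0 at v, so `hymul` applies
  -- term by term.
  have hyG : ∀ v w, v ≠ w → ∀ m a, y v (G w m * a) = G w m * y v a := fun v w hvw m => by
    have h0 : ∀ m : ℤ, n v ((t w)⁻¹ ^ m) = 0 := fun m => by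
      rw [hnpow, hninv, hnt, if_neg hvw.symm, neg_zero, mul_zero]
    induction m using Int.induction_on with
    | zero => simp [hG0]
    | succ m ih => intro a; rw [hG, add_mul, map_add, ih, hymul v _ (h0 _), add_mul]
    | pred m ih =>
      intro a
      have h1 := hG w (-(m : ℤ) - 1)
      rw [sub_add_cancel] at h1
      rw [eq_sub_of_add_eq h1.symm, sub_mul, map_sub, ih, hymul v _ (h0 _), sub_mul]
  refine ⟨y, ⟨fun v => ?_, fun v w => ?_, fun v w => ?_, fun v w hvw => ?_⟩, fun v γ hγ => ?_,
    fun v γ hγ a => ?_⟩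
  · refine b.ext fun γ => ?_
    have h1 : p v ((t v)⁻¹ * γ) = p v γ := by
      simp only [p, hn, hninv, hnt, if_true]
      rw [neg_add, neg_neg, zpow_add, zpow_one, mul_comm _ γ, mul_assoc, inv_mul_cancel_left]
    have h2 : (t v)⁻¹ ^ (-n v γ) * p v γ = γ := by
      simp only [p, inv_zpow']
      rw [neg_neg, mul_comm, mul_assoc, ← zpow_add]
      simp
    have h3 : -n v ((t v)⁻¹ * γ) = -n v γ + 1 := by
      rw [hn, hninv, hnt, if_pos rfl]
      ring
    rw [hb, Module.End.mul_apply, hxof, map_sub, hy, hy, h1, h3, hG, add_mul, add_sub_cancel_left,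
      ← map_mul, h2, Module.End.one_apply]
  · refine LinearMap.ext fun a => ?_
    rw [Module.End.mul_apply, Module.End.mul_apply, hx, hx, hx, hx]
    ring
  · rcases eq_or_ne v w with rfl | hvw
    · exact Commute.refl _
    have hnp : ∀ v w γ, v ≠ w → n v (p w γ) = n v γ := fun v w γ hvw => by
      simp only [p, hn, hnpow, hnt, if_neg hvw.symm, mul_zero, add_zero]
    refine b.ext fun γ => ?_
    rw [hb, Module.End.mul_apply, Module.End.mul_apply, hy, hy, hyG v w hvw, hyG w v hvw.symm, hy,
      hy, hnp v w γ hvw, hnp w v γ hvw.symm, mul_left_comm]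
    congr 3
    simp only [p, hn, hnpow, hnt, if_neg hvw, if_neg hvw.symm, mul_zero, add_zero]
    exact mul_right_comm _ _ _
  · refine LinearMap.ext fun a => ?_
    rw [Module.End.mul_apply, Module.End.mul_apply, hx, hx, map_sub, hymul]
    rw [hninv, hnt, if_neg hvw, neg_zero]
  · have h0 : n v γ = 0 := congrArg Multiplicative.toAdd hγ
    rw [hb, hproj]
    simp [p, h0]
  · have h0 : n v γ ≠ 0 := fun h => hγ (Multiplicative.toAdd.injective h)
    suffices h : (b.coord γ) ∘ₗ (IsSplitFamily.proj x y v) = 0 from LinearMap.congr_fun h a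
    refine b.ext fun γ' => ?_
    rw [hb, LinearMap.comp_apply, hproj, ← hb, Module.Basis.coord_apply, Module.Basis.repr_self,
      Finsupp.single_eq_of_ne]
    · rfl
    · rintro rfl
      refine h0 ?_
      simp only [p, hn, hnpow, hnt, if_true, mul_one, add_neg_cancel]

end GroupRing

/-! ### Twisted cohomology as a direct sum over links. -/

namespace PreAbstractSimplicialComplex

section

variable {V : Type u} {k : Type w} [CommRing k] {A : Type*} [AddCommGroup A] [Module k A]
  (K : PreAbstractSimplicialComplex V) {Γ : Type*}

/-- The index set of the summands of the degree `p` cohomology of a complex of twisted cochains. -/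
structure LinkIndex (fix : V → Set Γ) (p : ℕ) where
  /-- the simplex whose link contributes to the cohomology -/
  base : Finset V
  base_mem : base ∈ K.simplices
  /-- the (shifted) degree in the cohomology of the link -/
  degree : ℕ
  card_add_degree : base.card + degree = p
  /-- the index of a basis vector -/
  elt : Γ
  elt_mem : ∀ v ∈ base, elt ∈ fix v

variable {K} [LinearOrder V] {x y : V → Module.End k A} (h : IsSplitFamily x y)
  (b : Module.Basis Γ k A) {fix : V → Set Γ} {p : ℕ}

/-- The inclusion of the cochains of the link of a simplex into the twisted cochains. -/
def LinkIndex.incl (i : K.LinkIndex fix p) :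
    ((K.link i.base).Simplex i.degree → k) →ₗ[k] (K.Simplex p → A) :=
  K.restrict k A p ∘ₗ totalIncl h i.base (b i.elt) ∘ₗ (K.link i.base).extend k k i.degree

/-- The projection of the twisted cochains to the cochains of the link of a simplex. -/
def LinkIndex.proj (i : K.LinkIndex fix p) :
    (K.Simplex p → A) →ₗ[k] ((K.link i.base).Simplex i.degree → k) :=
  (K.link i.base).restrict k k i.degree ∘ₗ totalProj b h i.base i.elt ∘ₗ K.extend k A p

theorem LinkIndex.incl_restrict (i : K.LinkIndex fix p) (c : Finset V → k) :
    i.incl h b ((K.link i.base).restrict k k i.degree c) =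
      K.restrict k A p (totalIncl h i.base (b i.elt) c) :=
  K.restrict_totalIncl_congr h i.base_mem _ i.card_add_degree (restrict_extend _ _ _)

theorem LinkIndex.proj_restrict (i : K.LinkIndex fix p) (F : Finset V → A) :
    i.proj h b (K.restrict k A p F) =
      (K.link i.base).restrict k k i.degree (totalProj b h i.base i.elt F) :=
  K.restrict_totalProj_congr h b i.base_mem _ i.card_add_degree (restrict_extend _ _ _)

variable {b} (hb : IsAdapted b x y fix)
include hb

theorem LinkIndex.proj_incl_self (i : K.LinkIndex fix p)
    (c : (K.link i.base).Simplex i.degree → k) : i.proj h b (i.incl h b c) = c := by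
  conv_rhs => rw [← restrict_extend (k := k) _ _ c]
  conv_lhs => rw [← restrict_extend (k := k) _ _ c]
  rw [incl_restrict, proj_restrict, restrict_eq_iff]
  intro t ht _
  exact totalProj_totalIncl_self h hb i.elt_mem ((mem_simplices_link _ i.base_mem).mp ht).1 _

theorem LinkIndex.proj_incl_of_ne (i i' : K.LinkIndex fix p) (hne : i' ≠ i)
    (c : (K.link i.base).Simplex i.degree → k) : i'.proj h b (i.incl h b c) = 0 := by
  rw [← restrict_extend (k := k) _ _ c, incl_restrict, proj_restrict,
    totalProj_totalIncl_of_ne h hb i.elt_mem, map_zero]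
  rintro ⟨h1, h2⟩
  refine hne ?_
  obtain ⟨r, hr, m, hm, γ, hγ⟩ := i
  obtain ⟨r', hr', m', hm', γ', hγ'⟩ := i'
  obtain rfl : r' = r := h1
  obtain rfl : γ' = γ := h2
  obtain rfl : m' = m := by omega
  rfl

/-- The index type may be infinite, but each cochain is a finite sum of its components; the span
expresses this. -/
theorem LinkIndex.mem_span [Fintype V] (f : K.Simplex p → A) :
    f ∈ Submodule.span k
      (Set.range fun i : K.LinkIndex fix p => i.incl h b (i.proj h b f)) := by
  classical
  obtain ⟨S, hS⟩ := exists_eq_sum_totalIncl_totalProj h b (K.extend k A p f)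
  have hf : f = K.restrict k A p (K.extend k A p f) := (restrict_extend _ _ _).symm
  suffices hmem : K.restrict k A p (K.extend k A p f) ∈ Submodule.span k
      (Set.range fun i : K.LinkIndex fix p => i.incl h b (i.proj h b f)) by
    rwa [restrict_extend] at hmem
  rw [hS, map_sum]
  refine Submodule.sum_mem _ fun r _ => ?_
  rw [map_sum]
  refine Submodule.sum_mem _ fun γ _ => ?_
  by_cases hr : r ∈ K.simplices ∧ r.card ≤ p
  · by_cases hγ : ∀ v ∈ r, γ ∈ fix v
    · refine Submodule.subset_span ⟨⟨r, hr.1, p - r.card, by omega, γ, hγ⟩, ?_⟩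
      dsimp only
      conv_lhs => rw [hf]
      rw [proj_restrict, incl_restrict]
    -- Such pairs (r, γ) are not indices: γ is outside `fix v` for some v ∈ r, and its coordinate
    -- vanishes on the image of `P r`.
    · push Not at hγ
      obtain ⟨v, hv, hγ⟩ := hγ
      rw [totalProj_eq_zero h hb hv hγ, map_zero, map_zero]
      exact Submodule.zero_mem _
  · rw [restrict_totalIncl_eq_zero K h _ hr]
    exact Submodule.zero_mem _

include h in
/-- The cohomology of the complex of twisted cochains is the direct sum of cohomologies of links. -/
theorem nonempty_directSum_link_linearEquiv [Fintype V] {Z B : Submodule k (K.Simplex p → A)}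
    (hZ : ∀ F, K.restrict k A p F ∈ Z ↔ K.restrict k A (p + 1) (totalCoboundary x F) = 0)
    (hB : ∀ f, f ∈ B ↔ ∃ F, K.restrict k A p (totalCoboundary x F) = f) :
    Nonempty ((DirectSum (K.LinkIndex fix p)
      fun i => (K.link i.base).shiftedReducedCohomology k i.degree) ≃ₗ[k]
        (Z ⧸ B.submoduleOf Z)) := by
  refine nonempty_subquotient_linearEquiv_directSum (LinkIndex.incl h b) (LinkIndex.proj h b)
    ?_ ?_ ?_ ?_ (LinkIndex.proj_incl_self h hb) (LinkIndex.proj_incl_of_ne h hb)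
    (LinkIndex.mem_span h hb)
  · intro i c hc
    have hdeg : i.base.card + (i.degree + 1) = p + 1 := by rw [← add_assoc, i.card_add_degree]
    rw [← restrict_extend (k := k) _ _ c] at hc ⊢
    rw [LinearMap.mem_ker, coboundary_restrict] at hc
    rw [LinkIndex.incl_restrict, hZ, totalCoboundary_totalIncl,
      K.restrict_totalIncl_congr h i.base_mem _ hdeg (hc.trans (map_zero _).symm), map_zero,
      map_zero]
  · intro i c hc
    obtain ⟨F, rfl⟩ := (mem_coboundaries_iff _).mp hc
    rw [LinkIndex.incl_restrict, ← totalCoboundary_totalIncl]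
    exact (hB _).mpr ⟨_, rfl⟩
  · intro i f hf
    have hdeg : i.base.card + (i.degree + 1) = p + 1 := by rw [← add_assoc, i.card_add_degree]
    rw [← restrict_extend (k := k) _ _ f] at hf ⊢
    rw [hZ] at hf
    rw [LinkIndex.proj_restrict, LinearMap.mem_ker, coboundary_restrict,
      restrict_totalCoboundary_totalProj K h b i.base_mem,
      K.restrict_totalProj_congr h b i.base_mem _ hdeg (hf.trans (map_zero _).symm), map_zero,
      map_zero]
  · intro i f hf
    obtain ⟨F, rfl⟩ := (hB f).mp hf
    rw [LinkIndex.proj_restrict, ← restrict_totalCoboundary_totalProj K h b i.base_mem]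
    exact (mem_coboundaries_iff _).mpr ⟨_, rfl⟩

end

end PreAbstractSimplicialComplex

/-! ### The cochain complex of the toric complex. -/

namespace AbstractSimplicialComplex

variable {V : Type u} [LinearOrder V] [Finite V] (L : AbstractSimplicialComplex V) (k : Type w)
  [CommRing k]

/-- The action of `t⁻¹ - 1` on the group ring, where `t` is the loop given by a vertex. -/
def loopOperator (v : V) :
    Module.End k (MonoidAlgebra k (Abelianization L.ToricGroup)) :=
  LinearMap.mulLeft k (MonoidAlgebra.of k _ (L.toricLoop v)⁻¹) - 1

theorem loopOperator_apply (v : V) (a : MonoidAlgebra k (Abelianization L.ToricGroup)) :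
    L.loopOperator k v a = MonoidAlgebra.of k _ (L.toricLoop v)⁻¹ * a - a := rfl

/-- The facets at 0 and 1 coincide, so each bracket in the cellular coboundary is t⁻¹ - 1 applied to
one value. -/
theorem toricCoboundary_restrict (n : ℕ)
    (F : Finset V → MonoidAlgebra k (Abelianization L.ToricGroup)) :
    L.toricCells.coboundary (abelianRep k L.ToricGroup) n
        (L.restrict k (MonoidAlgebra k (Abelianization L.ToricGroup)) n F) =
      L.restrict k (MonoidAlgebra k (Abelianization L.ToricGroup)) (n + 1)
        (totalCoboundary (L.loopOperator k) F) := by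
  refine funext fun (σ : L.Simplex (n + 1)) => ?_
  refine Eq.trans ?_ (PreAbstractSimplicialComplex.totalCoboundary_verts
    (L.loopOperator k) F σ).symm
  change ∑ i : Fin (n + 1), (-1 : k) ^ (i : ℕ) •
    (abelianRep k L.ToricGroup (L.toricCells.edge σ i)⁻¹ (F (σ.facet i).verts) -
      F (σ.facet i).verts) = _
  refine Finset.sum_congr rfl fun i _ => ?_
  rw [loopOperator_apply, ← L.of_edge σ i, ← map_inv]
  rfl

theorem mem_toricCoboundaries_iff {n : ℕ}
    (f : L.Simplex n → MonoidAlgebra k (Abelianization L.ToricGroup)) :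
    f ∈ L.toricCells.coboundaries (abelianRep k L.ToricGroup) n ↔
      ∃ F, L.restrict k (MonoidAlgebra k (Abelianization L.ToricGroup)) n
        (totalCoboundary (L.loopOperator k) F) = f := by
  cases n with
  | zero =>
    simp only [PreAbstractSimplicialComplex.restrict_zero_totalCoboundary, exists_const]
    exact Iff.trans Iff.rfl eq_comm
  | succ n =>
    refine ⟨fun hf => ?_, fun ⟨F, hF⟩ => ⟨L.restrict k _ n F, ?_⟩⟩
    · obtain ⟨g, hg⟩ : ∃ g : L.Simplex n → MonoidAlgebra k (Abelianization L.ToricGroup),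
        L.toricCells.coboundary (abelianRep k L.ToricGroup) n g = f := hf
      refine ⟨L.extend k _ n g, ?_⟩
      rw [← toricCoboundary_restrict, PreAbstractSimplicialComplex.restrict_extend, hg]
    · rw [toricCoboundary_restrict, hF]

/-- The cohomology of the toric complex with coefficients in the group ring of the abelianized
fundamental group is a direct sum of copies of the reduced cohomology of the links of simplices. -/
theorem nonempty_directSum_toricCohomology (p : ℕ) :
    Nonempty ((DirectSum (L.LinkIndex (fun v => {γ | L.toricWinding v γ = 1}) p)
      fun i => (L.link i.base).shiftedReducedCohomology k i.degree) ≃ₗ[k]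
        L.ToricCohomology (abelianRep k L.ToricGroup) p) := by
  have := Fintype.ofFinite V
  obtain ⟨y, h, hb⟩ := exists_isSplitFamily k L.toricLoop L.toricWinding L.toricWinding_toricLoop
    (MonoidAlgebra.basis _ k) (fun _ => rfl) (L.loopOperator k) (L.loopOperator_apply k)
  let Z : Submodule k (L.Simplex p → MonoidAlgebra k (Abelianization L.ToricGroup)) :=
    LinearMap.ker (L.toricCells.coboundary (abelianRep k L.ToricGroup) p)
  have hZ : ∀ F, L.restrict k _ p F ∈ Z ↔
        L.restrict k _ (p + 1) (totalCoboundary (L.loopOperator k) F) = 0 := fun F => by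
    rw [← toricCoboundary_restrict]
    exact LinearMap.mem_ker
  exact PreAbstractSimplicialComplex.nonempty_directSum_link_linearEquiv h hb hZ
    (L.mem_toricCoboundaries_iff k)

end AbstractSimplicialComplex

/-! ### Maximal simplices and finiteness. -/

namespace PreAbstractSimplicialComplex

variable {V : Type u} (K : PreAbstractSimplicialComplex V)

instance [Finite V] (n : ℕ) : Finite (K.Simplex n) :=
  Finite.of_injective Simplex.verts fun _ _ => Simplex.ext


theorem exists_maximal_simplex [Finite V] {σ : Finset V} (hσ : σ ∈ K.simplices) :
    ∃ τ ∈ K.simplices, σ ⊆ τ ∧ ∀ τ' ∈ K.simplices, τ ⊆ τ' → τ'.card ≤ τ.card := by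
  obtain ⟨τ, ⟨hτ, hστ⟩, hmax⟩ := Set.Finite.exists_maximalFor Finset.card
    {τ | τ ∈ K.simplices ∧ σ ⊆ τ} (Set.toFinite _) ⟨σ, hσ, subset_rfl⟩
  refine ⟨τ, hτ, hστ, fun τ' hτ' h => ?_⟩
  by_contra hlt
  exact hlt (hmax ⟨hτ', hστ.trans h⟩ (not_le.mp hlt).le)

variable [LinearOrder V] (k : Type w) [CommRing k]

instance [Finite V] [IsNoetherianRing k] (n : ℕ) :
    Module.Finite k (K.shiftedReducedCohomology k n) := by
  have : Module.Finite k ↥(LinearMap.ker (K.coboundary k n)) := inferInstance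
  exact Module.Finite.quotient k _

/-- Without vertices the constant cochain 1 on ∅ is a cocycle, and there are no nonzero coboundaries
in this degree. -/
theorem nontrivial_shiftedReducedCohomology_zero [Nontrivial k] (h : K.faces = ∅) :
    Nontrivial (K.shiftedReducedCohomology k 0) := by
  have h1 : IsEmpty (K.Simplex 1) := ⟨fun σ => by
    rcases σ.mem_simplices with h0 | h0
    · simpa [h0] using σ.card_eq
    · rw [h] at h0
      exact h0⟩
  let c : LinearMap.ker (K.coboundary k 0) := ⟨fun _ => 1, Subsingleton.elim _ _⟩
  refine ⟨Submodule.Quotient.mk c, 0, fun hc => ?_⟩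
  rw [Submodule.Quotient.mk_eq_zero] at hc
  have hc' : (fun _ => 1 : K.Simplex 0 → k) = 0 := hc
  exact one_ne_zero (congrFun hc' ⟨∅, Or.inl rfl, Finset.card_empty⟩)

theorem faces_link_eq_empty {σ : Finset V}
    (h : ∀ τ ∈ K.simplices, σ ⊆ τ → τ.card ≤ σ.card) : (K.link σ).faces = ∅ := by
  refine Set.eq_empty_iff_forall_notMem.mpr fun τ ⟨h0, h1, h2⟩ => ?_
  have h3 := h _ h2 Finset.subset_union_left
  rw [Finset.card_union_of_disjoint h1] at h3
  have := h0.card_pos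
  omega

end PreAbstractSimplicialComplex

/-! ### The Cohen–Macaulay criterion. -/

namespace AbstractSimplicialComplex

variable {V : Type u} [LinearOrder V] [Finite V] (L : AbstractSimplicialComplex V) (k : Type w)
  [CommRing k]

/-- The summand indexed by σ and the group element 1, which has winding number 0 at every vertex. -/
theorem exists_injective_shiftedReducedCohomology_link {σ : Finset V} (hσ : σ ∈ L.simplices)
    (n : ℕ) : ∃ f : (L.link σ).shiftedReducedCohomology k n →ₗ[k]
      L.ToricCohomology (abelianRep k L.ToricGroup) (σ.card + n), Function.Injective f := by
  classical
  obtain ⟨e⟩ := L.nonempty_directSum_toricCohomology k (σ.card + n)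
  let i : L.LinkIndex (fun v => {γ | L.toricWinding v γ = 1}) (σ.card + n) :=
    ⟨σ, hσ, n, rfl, 1, fun v _ => map_one (L.toricWinding v)⟩
  exact ⟨e.toLinearMap ∘ₗ DirectSum.lof k _
    (fun i => (L.link i.base).shiftedReducedCohomology k i.degree) i,
    fun a b hab => DirectSum.of_injective i (e.injective hab)⟩

theorem subsingleton_toricCohomology {p : ℕ} (h : ∀ σ ∈ L.simplices, ∀ n, σ.card + n = p →
    Subsingleton ((L.link σ).shiftedReducedCohomology k n)) :
    Subsingleton (L.ToricCohomology (abelianRep k L.ToricGroup) p) := by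
  obtain ⟨e⟩ := L.nonempty_directSum_toricCohomology k p
  refine e.symm.toEquiv.subsingleton_congr.mpr ⟨fun a b => ?_⟩
  exact DFinsupp.ext fun i =>
    (h i.base i.base_mem i.degree i.card_add_degree).elim _ _

/-- Each summand is finitely generated and torsion-free over a PID, hence free; a possibly infinite
direct sum of free modules stays free. -/
theorem free_toricCohomology [IsDomain k] [IsPrincipalIdealRing k] {p : ℕ}
    (h : ∀ σ ∈ L.simplices, ∀ n, σ.card + n = p →
      Module.IsTorsionFree k ((L.link σ).shiftedReducedCohomology k n)) :
    Module.Free k (L.ToricCohomology (abelianRep k L.ToricGroup) p) := by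
  obtain ⟨e⟩ := L.nonempty_directSum_toricCohomology k p
  have : ∀ i : L.LinkIndex (fun v => {γ | L.toricWinding v γ = 1}) p,
      Module.Free k ((L.link i.base).shiftedReducedCohomology k i.degree) := fun i => by
    have := h i.base i.base_mem i.degree i.card_add_degree
    exact Module.free_of_finite_type_torsion_free'
  exact Module.Free.of_equiv e

theorem nontrivial_toricCohomology_of_maximal [Nontrivial k] {σ : Finset V}
    (hσ : σ ∈ L.simplices) (h : ∀ τ ∈ L.simplices, σ ⊆ τ → τ.card ≤ σ.card) :
    Nontrivial (L.ToricCohomology (abelianRep k L.ToricGroup) σ.card) := by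
  obtain ⟨f, hf⟩ := L.exists_injective_shiftedReducedCohomology_link k hσ 0
  have := (L.link σ).nontrivial_shiftedReducedCohomology_zero k (L.faces_link_eq_empty h)
  exact hf.nontrivial

variable {k} in
theorem subsingleton_toricCohomology_of_isCohenMacaulay {d : ℤ} (h : L.IsCohenMacaulay k d)
    {p : ℕ} (hp : (p : ℤ) ≠ d + 1) :
    Subsingleton (L.ToricCohomology (abelianRep k L.ToricGroup) p) :=
  L.subsingleton_toricCohomology k fun σ hσ n hn => (h.2 σ hσ n).1 (by omega)

variable {k} in
theorem free_toricCohomology_of_isCohenMacaulay [IsDomain k] [IsPrincipalIdealRing k] {d : ℤ}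
    (h : L.IsCohenMacaulay k d) {p : ℕ} (hp : (p : ℤ) = d + 1) :
    Module.Free k (L.ToricCohomology (abelianRep k L.ToricGroup) p) :=
  L.free_toricCohomology k fun σ hσ n hn => (h.2 σ hσ n).2 (by omega)

theorem isCohenMacaulay_of_toricCohomology [Nontrivial k] {d : ℤ}
    (h0 : ∀ p : ℕ, (p : ℤ) ≠ d + 1 →
      Subsingleton (L.ToricCohomology (abelianRep k L.ToricGroup) p))
    (h1 : ∀ p : ℕ, (p : ℤ) = d + 1 →
      Module.IsTorsionFree k (L.ToricCohomology (abelianRep k L.ToricGroup) p)) :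
    L.IsCohenMacaulay k d := by
  -- Purity: a maximal simplex τ gives nonzero cohomology in degree |τ|, so |τ| = d + 1.
  have hmax : ∀ σ ∈ L.simplices, ∃ τ ∈ L.simplices, σ ⊆ τ ∧ (τ.card : ℤ) = d + 1 := by
    intro σ hσ
    obtain ⟨τ, hτ, hστ, hmax⟩ := L.exists_maximal_simplex hσ
    refine ⟨τ, hτ, hστ, ?_⟩
    by_contra hne
    have := L.nontrivial_toricCohomology_of_maximal k hτ hmax
    exact not_subsingleton _ (h0 _ hne)
  refine ⟨⟨fun σ hσ => ?_, ?_⟩, fun σ hσ n => ?_⟩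
  · obtain ⟨τ, -, hστ, hτ⟩ := hmax σ hσ
    have := Finset.card_le_card hστ
    omega
  · obtain ⟨τ, hτ, -, h⟩ := hmax ∅ (Or.inl rfl)
    exact ⟨τ, hτ, h⟩
  · obtain ⟨f, hf⟩ := L.exists_injective_shiftedReducedCohomology_link k hσ n
    refine ⟨fun hn => ?_, fun hn => ?_⟩
    · have := h0 (σ.card + n) (by push_cast; omega)
      exact hf.subsingleton
    · have := h1 (σ.card + n) (by push_cast; omega)
      exact hf.moduleIsTorsionFree f (map_smul f)

theorem isCohenMacaulay_iff [IsDomain k] [IsPrincipalIdealRing k] (d : ℤ) :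
    L.IsCohenMacaulay k d ↔
      (∀ p : ℕ, (p : ℤ) ≠ d + 1 →
        Subsingleton (L.ToricCohomology (abelianRep k L.ToricGroup) p)) ∧
      (∀ p : ℕ, (p : ℤ) = d + 1 →
        Module.Free k (L.ToricCohomology (abelianRep k L.ToricGroup) p)) := by
  refine ⟨fun h => ⟨fun p => L.subsingleton_toricCohomology_of_isCohenMacaulay h,
    fun p => L.free_toricCohomology_of_isCohenMacaulay h⟩, fun ⟨h0, h1⟩ =>
    L.isCohenMacaulay_of_toricCohomology k h0 fun p hp => ?_⟩
  have := h1 p hp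
  infer_instance

theorem isAbelianDualitySpace_iff (n : ℕ) :
    L.toricCells.IsAbelianDualitySpace n ↔ L.IsCohenMacaulay ℤ ((n : ℤ) - 1) := by
  constructor
  · rintro ⟨-, h0, -, h1⟩
    refine L.isCohenMacaulay_of_toricCohomology ℤ (fun p hp => h0 p (by omega)) fun p hp => ?_
    obtain rfl : p = n := by omega
    exact h1
  · intro h
    have hfree := L.free_toricCohomology_of_isCohenMacaulay h (p := n) (by omega)
    refine ⟨fun q => inferInstanceAs (Finite (L.Simplex q)),
      fun p hp => L.subsingleton_toricCohomology_of_isCohenMacaulay h (by omega), ?_,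
      inferInstanceAs (Module.IsTorsionFree ℤ
        (L.ToricCohomology (abelianRep ℤ L.ToricGroup) n))⟩
    -- Nonvanishing is automatic: a simplex of top dimension is maximal.
    obtain ⟨σ, hσ, hcard⟩ := h.1.2
    obtain rfl : σ.card = n := by omega
    refine L.nontrivial_toricCohomology_of_maximal ℤ hσ fun τ hτ _ => ?_
    have := h.1.1 τ hτ
    omega

end AbstractSimplicialComplex

end

theorem mainTheorem12 {V : Type u} [Finite V] [LinearOrder V] (L : AbstractSimplicialComplex V) :
    (∀ (k : Type w) [CommRing k], (IsField k ∨ Nonempty (k ≃+* ℤ)) → ∀ d : ℤ,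
      (L.IsCohenMacaulay k d ↔
        (∀ p : ℕ, (p : ℤ) ≠ d + 1 →
          Subsingleton (L.ToricCohomology (abelianRep k L.ToricGroup) p)) ∧
        (∀ p : ℕ, (p : ℤ) = d + 1 →
          Module.Free k (L.ToricCohomology (abelianRep k L.ToricGroup) p)))) ∧
    (∀ n : ℕ, L.toricCells.IsAbelianDualitySpace n ↔ L.IsCohenMacaulay ℤ ((n : ℤ) - 1)) ∧
    ((∃ n : ℕ, L.toricCells.IsAbelianDualitySpace n) ↔ ∃ d : ℤ, L.IsCohenMacaulay ℤ d) := by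
  refine ⟨fun k _ hk d => ?_, L.isAbelianDualitySpace_iff, ?_⟩
  -- Both cases are instances of the criterion over a PID.
  · rcases hk with hk | ⟨⟨e⟩⟩
    · have : IsDomain k := hk.isDomain
      have : IsPrincipalIdealRing k := hk.isPrincipalIdealRing
      exact L.isCohenMacaulay_iff k d
    · have : IsDomain k := MulEquiv.isDomain ℤ e.toMulEquiv
      have : IsPrincipalIdealRing k :=
        IsPrincipalIdealRing.of_surjective e.symm.toRingHom e.symm.surjective
      exact L.isCohenMacaulay_iff k d
  · constructor
    · rintro ⟨n, hn⟩
      exact ⟨_, (L.isAbelianDualitySpace_iff n).mp hn⟩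
    · rintro ⟨d, hd⟩
      -- The dimension d is attained by a simplex, so d + 1 is a natural number, namely |σ|.
      obtain ⟨σ, hσ, hcard⟩ := hd.1.2
      refine ⟨σ.card, (L.isAbelianDualitySpace_iff _).mpr ?_⟩
      rwa [hcard, add_sub_cancel_right]
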